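/- Let $d\ge 1$, let $(Z_i)_{i\in\mathbb Z}$ be i.i.d. random vectors in $\mathbb R^d$ with zero mean whose distribution is regularly varying with exponent $\alpha>1$: there is a nonzero Radon measure $\nu$ on $[-\infty,\infty]^d\setminus\{0\}$ such that $P(Z_0\in u\,\cdot)/P(\|Z_0\|>u)\to\nu(\cdot)$ vaguely on $[-\infty,\infty]^d\setminus\{0\}$ as $u\to\infty$, and $\nu(c\Phi)=c^{-\alpha}\nu(\Phi)$ for all measurable $\Phi\subset[-\infty,\infty]^d\setminus\{0\}$ and $c>0$. Let $(A_i)_{i\in\mathbb Z}$ be deterministic real $d\times d$ matrices with $\sum_{i\in\mathbb Z}\|A_i\|<\infty$ ($\ell_2/\ell_2$ operator norm) and with $\mathcal A=\sum_{i\in\mathbb Z}A_i$ invertible, and put $$X_k=\sum_{i=-\infty}^{\infty}A_iZ_{k-i}\quad(k\in\mathbb Z),\qquad S_0^n=\sum_{k=0}^{n-1}X_k .$$ Let $\Gamma\subset\mathbb R^d$ be a measurable set that is bounded away from the origin (disjoint from a closed ball of radius $\delta_0>0$ centered at $0$) and satisfies $\nu(\mathcal A^{-1}\Gamma)>0$ and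 $\nu(\mathcal A^{-1}\partial\Gamma)=0$. For real sequences write $a_n\sim b_n$ if both are eventually nonvanishing and $a_n/b_n\to1$ as $n\to\infty$. Let $M,\delta>0$ and let $I_n\subset\{0,\dots,n-1\}$, $n=1,2,\dots$, be such that $|I_n|\to\infty$. Then any two of the following five quantities are asymptotically equivalent ($\sim$) as $n\to\infty$: 1. $(|I_n|/n)\,P(S_0^n\in n\Gamma)$; 2. $|I_n|\,P(\mathcal A Z_0\in n\Gamma)$; 3. $P(\text{there is } i\in I_n \text{ with } \mathcal A Z_i\in n\Gamma)$; 4. $P(S_0^n\in n\Gamma \text{ and there is } i\in I_n \text{ with } \mathcal A Z_i\in n\Gamma)$; 5. $P(S_0^n\in n\Gamma, \text{ and there is } i\in I_n \text{ with } \mathcal A Z_i\in n\Gamma \text{ and } \|Z_l\|\le n\delta \text{ for all integers } l\ne i \text{ in } [-nM,nM])$. In particular, $$\lim_{n\to\infty}\frac{P(S_0^n\in n\Gamma)}{n\,P(\mathcal A Z_0\in n\Gamma)}=1 .$$ -/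

import Mathlib

open MeasureTheory ProbabilityTheory Filter Topology
open scoped Pointwise

namespace MovingAverage

noncomputable section

/-- The space `ℝ^d` with its Euclidean norm. -/
abbrev Vec (d : ℕ) : Type := EuclideanSpace ℝ (Fin d)

/-- A real `d × d` matrix as an operator on Euclidean space; the norm of `op A` is the `ℓ²/ℓ²`
operator norm of the matrix `A`. -/
abbrev op {d : ℕ} (A : Matrix (Fin d) (Fin d) ℝ) : Vec d →L[ℝ] Vec d :=
  Matrix.toEuclideanCLM (n := Fin d) (𝕜 := ℝ) A

/-! ### Regular variation on `[-∞, ∞]^d ∖ {0}` -/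

/-- The punctured compactified space `[-∞, ∞]^d ∖ {0}`. -/
abbrev Punctured (d : ℕ) : Type := {x : Fin d → EReal // x ≠ 0}

/-- The embedding of `ℝ^d` into `[-∞, ∞]^d`. -/
def toExt {d : ℕ} (y : Vec d) : Fin d → EReal := fun i => ((y i : ℝ) : EReal)

/-- A subset of `ℝ^d` (without the origin, if it contains it) as a subset of
`[-∞, ∞]^d ∖ {0}`. -/
def extSet {d : ℕ} (S : Set (Vec d)) : Set (Punctured d) := {x | ∃ y ∈ S, toExt y = x.1}

/-- The set `c Φ = {c x : x ∈ Φ}` for `Φ ⊆ [-∞, ∞]^d ∖ {0}`. -/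
def dilate {d : ℕ} (c : ℝ) (Φ : Set (Punctured d)) : Set (Punctured d) :=
  {x | ∃ y ∈ Φ, x.1 = fun i => (c : EReal) * y.1 i}

variable {Ω : Type*} [MeasurableSpace Ω]

/-- The measure `B ↦ P(Y ∈ u B)` on `[-∞, ∞]^d ∖ {0}`, that is, the law of `Y / u` restricted
to the complement of the origin. -/
def scaledLaw {d : ℕ} (P : Measure Ω) (Y : Ω → Vec d) (u : ℝ) : Measure (Punctured d) :=
  (P.map (fun ω => toExt (u⁻¹ • Y ω))).comap Subtype.val

lemma measurable_toExt {d : ℕ} : Measurable (toExt : Vec d → Fin d → EReal) := by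
  unfold toExt
  fun_prop

lemma scaledLaw_apply {d : ℕ} (P : Measure Ω) {Y : Ω → Vec d} (hY : Measurable Y) (u : ℝ)
    {B : Set (Punctured d)} (hB : MeasurableSet B) :
    scaledLaw P Y u B = P {ω | ∃ x ∈ B, x.1 = toExt (u⁻¹ • Y ω)} := by
  have h0 : MeasurableSet {x : Fin d → EReal | x ≠ 0} := (measurableSet_singleton _).compl
  have he : MeasurableEmbedding (Subtype.val : Punctured d → Fin d → EReal) :=
    MeasurableEmbedding.subtype_coe h0
  have hm : Measurable fun ω => toExt (u⁻¹ • Y ω) := measurable_toExt.comp (hY.const_smul u⁻¹)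
  rw [scaledLaw, he.comap_apply, Measure.map_apply hm (he.measurableSet_image.2 hB)]
  rfl

/-- The distribution of `Y` is regularly varying, `Y ∈ RV(ν, α)`: `ν` is a nonzero Radon measure
on `[-∞, ∞]^d ∖ {0}`, the measures `P(Y ∈ u ·) / P(‖Y‖ > u)` converge vaguely to `ν` as
`u → ∞`, and `ν(c Φ) = c^{-α} ν(Φ)` for all measurable `Φ` and `c > 0`. (The space is locally
compact with a countable base, so a Borel measure on it is Radon as soon as it is finite on
compact sets.) -/
structure IsRegularlyVarying {d : ℕ} (P : Measure Ω) (Y : Ω → Vec d)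
    (ν : Measure (Punctured d)) (α : ℝ) : Prop where
  radon : IsFiniteMeasureOnCompacts ν
  ne_zero : ν ≠ 0
  vague : ∀ f : Punctured d → ℝ, Continuous f → HasCompactSupport f →
    Tendsto (fun u : ℝ => (∫ x, f x ∂(scaledLaw P Y u)) / P.real {ω | u < ‖Y ω‖})
      atTop (𝓝 (∫ x, f x ∂ν))
  homogeneous : ∀ c : ℝ, 0 < c → ∀ Φ : Set (Punctured d), MeasurableSet Φ →
    ν (dilate c Φ) = ENNReal.ofReal (c ^ (-α)) * ν Φ

/-! ### The noise, the coefficients and the moving average process -/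

/-- The noise `(Z_i)_{i ∈ ℤ}`: i.i.d. random vectors in `ℝ^d` with zero mean, whose common
distribution is regularly varying with tail measure `ν` and exponent `α > 1`. -/
structure IsNoise {d : ℕ} (P : Measure Ω) (Z : ℤ → Ω → Vec d)
    (ν : Measure (Punctured d)) (α : ℝ) : Prop where
  measurable : ∀ i, Measurable (Z i)
  indep : iIndepFun Z P
  identDistrib : ∀ i, IdentDistrib (Z i) (Z 0) P P
  integrable : Integrable (Z 0) P
  mean_zero : ∫ ω, Z 0 ω ∂P = 0
  one_lt : 1 < α
  regVar : IsRegularlyVarying P (Z 0) ν α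

/-- The matrix `𝒜 = ∑_i A_i`. -/
def coefSum {d : ℕ} (A : ℤ → Matrix (Fin d) (Fin d) ℝ) : Matrix (Fin d) (Fin d) ℝ :=
  ∑' i, A i

/-- The conditions on the coefficients: `∑_i ‖A_i‖ < ∞` and `𝒜` is invertible. -/
structure IsCoef {d : ℕ} (A : ℤ → Matrix (Fin d) (Fin d) ℝ) : Prop where
  summable_norm : Summable fun i => ‖op (A i)‖
  invertible : IsUnit (coefSum A)

/-- The moving average process `X_k = ∑_i A_i Z_{k-i}`. -/
def X {d : ℕ} (A : ℤ → Matrix (Fin d) (Fin d) ℝ) (Z : ℤ → Ω → Vec d) (k : ℤ) (ω : Ω) : Vec d :=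
  ∑' i : ℤ, op (A i) (Z (k - i) ω)

/-- The series defining the moving average process converge almost surely. -/
lemma ae_summable_X {d : ℕ} {P : Measure Ω} {A : ℤ → Matrix (Fin d) (Fin d) ℝ}
    {Z : ℤ → Ω → Vec d} {ν : Measure (Punctured d)} {α : ℝ}
    (hA : IsCoef A) (hZ : IsNoise P Z ν α) :
    ∀ᵐ ω ∂P, ∀ k : ℤ, Summable fun i : ℤ => op (A i) (Z (k - i) ω) := by
  rw [ae_all_iff]
  intro k
  have hm : ∀ i : ℤ, Measurable fun ω => ‖op (A i)‖ₑ * ‖Z (k - i) ω‖ₑ := fun i =>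
    ((hZ.measurable _).enorm).const_mul _
  have hE : ∀ i, ∫⁻ ω, ‖Z i ω‖ₑ ∂P = ∫⁻ ω, ‖Z 0 ω‖ₑ ∂P := fun i =>
    ((hZ.identDistrib i).comp measurable_enorm).lintegral_eq
  have hfin : ∫⁻ ω, ∑' i : ℤ, ‖op (A i)‖ₑ * ‖Z (k - i) ω‖ₑ ∂P ≠ ⊤ := by
    rw [lintegral_tsum fun i => (hm i).aemeasurable]
    have : ∀ i : ℤ, ∫⁻ ω, ‖op (A i)‖ₑ * ‖Z (k - i) ω‖ₑ ∂P
        = ‖op (A i)‖ₑ * ∫⁻ ω, ‖Z 0 ω‖ₑ ∂P := fun i => by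
      rw [lintegral_const_mul _ (hZ.measurable _).enorm, hE]
    simp_rw [this]
    rw [ENNReal.tsum_mul_right]
    refine ENNReal.mul_ne_top ?_ hZ.integrable.2.ne
    have h := hA.summable_norm.tsum_ofReal_ne_top
    simpa only [ofReal_norm] using h
  filter_upwards [ae_lt_top' (AEMeasurable.tsum fun i => (hm i).aemeasurable) hfin]
    with ω hω
  have h1 := ENNReal.summable_toReal hω.ne
  refine Summable.of_norm_bounded h1 fun i => ?_
  simpa [ENNReal.toReal_mul] using (op (A i)).le_opNorm (Z (k - i) ω)

/-- The sums `S_j^n = X_j + ⋯ + X_{n+j-1}`. -/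
def S {d : ℕ} (A : ℤ → Matrix (Fin d) (Fin d) ℝ) (Z : ℤ → Ω → Vec d) (j : ℤ) (n : ℕ) (ω : Ω) :
    Vec d :=
  ∑ k ∈ Finset.Ico j (j + n), X A Z k ω

/-- The assumption on the failure set `Γ`: it is measurable, bounded away from the origin, and
`ν(𝒜⁻¹ Γ) > 0`, `ν(𝒜⁻¹ ∂Γ) = 0`. -/
structure IsFailureSet {d : ℕ} (A : ℤ → Matrix (Fin d) (Fin d) ℝ) (ν : Measure (Punctured d))
    (Γ : Set (Vec d)) : Prop where
  measurableSet : MeasurableSet Γ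
  bounded_away : ∃ δ₀ : ℝ, 0 < δ₀ ∧ Γ ⊆ (Metric.closedBall (0 : Vec d) δ₀)ᶜ
  pos : 0 < ν (extSet (op (coefSum A) ⁻¹' Γ))
  frontier_null : ν (extSet (op (coefSum A) ⁻¹' frontier Γ)) = 0

/-! ### The asymptotic equivalence -/

/-- `a_n ∼ b_n`: both sequences are eventually nonvanishing and `a_n / b_n → 1`. -/
def AsympEquiv (a b : ℕ → ℝ) : Prop :=
  (∀ᶠ n in atTop, a n ≠ 0) ∧ (∀ᶠ n in atTop, b n ≠ 0) ∧
    Tendsto (fun n => a n / b n) atTop (𝓝 1)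

/-- The five quantities, in the order
1. `(|I_n| / n) P(S_0^n ∈ n Γ)`;
2. `|I_n| P(𝒜 Z_0 ∈ n Γ)`;
3. `P(there is i ∈ I_n with 𝒜 Z_i ∈ n Γ)`;
4. `P(S_0^n ∈ n Γ and there is i ∈ I_n with 𝒜 Z_i ∈ n Γ)`;
5. `P(S_0^n ∈ n Γ and there is i ∈ I_n with 𝒜 Z_i ∈ n Γ and ‖Z_l‖ ≤ n δ for all l ≠ i
  in [-n M, n M])`. -/
def quantity {d : ℕ} (P : Measure Ω) (A : ℤ → Matrix (Fin d) (Fin d) ℝ) (Z : ℤ → Ω → Vec d)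
    (Γ : Set (Vec d)) (I : ℕ → Finset ℕ) (M δ : ℝ) : Fin 5 → ℕ → ℝ :=
  ![fun n => ((I n).card : ℝ) / n * P.real {ω | S A Z 0 n ω ∈ (n : ℝ) • Γ},
    fun n => (I n).card * P.real {ω | op (coefSum A) (Z 0 ω) ∈ (n : ℝ) • Γ},
    fun n => P.real {ω | ∃ i ∈ I n, op (coefSum A) (Z (i : ℤ) ω) ∈ (n : ℝ) • Γ},
    fun n => P.real {ω | S A Z 0 n ω ∈ (n : ℝ) • Γ ∧
      ∃ i ∈ I n, op (coefSum A) (Z (i : ℤ) ω) ∈ (n : ℝ) • Γ},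
    fun n => P.real {ω | S A Z 0 n ω ∈ (n : ℝ) • Γ ∧
      ∃ i ∈ I n, op (coefSum A) (Z (i : ℤ) ω) ∈ (n : ℝ) • Γ ∧
        ∀ l : ℤ, l ≠ (i : ℤ) → -(n * M) ≤ (l : ℝ) → (l : ℝ) ≤ n * M → ‖Z l ω‖ ≤ n * δ}]

end

end MovingAverage

open MovingAverage

namespace MovingAverage

/-! ### Consequences of regular variation -/

section RegularVariation

set_option linter.unusedSectionVars false

/-! This is the principle of a single big jump. Write `S_0^n = ∑_j W_j Z_j` with `W_j = weight A n
j`. These weights are bounded, are close to `𝒜` for `j` inside `[0, n)` away from the ends, and have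
total norm at most `η n + O(1)` over all other `j`. With probability close enough to one, a sum of
order `n` is produced by one summand of order `n`. If its index `i` is well inside the window, then
`S_0^n` is close to `𝒜 Z_i`.

Let `q(n) = P(‖Z_0‖ > n)` and `p_n = P(𝒜 Z_0 ∈ n Γ)`. Since `Γ` has a `ν`-null boundary and positive
mass, `p_n ≥ m q(n)` for some `m > 0` and all large `n`, so errors may be measured in units of
`q(n)`. Four estimates control them. (a) A sum above `ε n` without a summand above `δ n` has
probability at most `q(n)`: exponential Markov bounds beat any power of `n`, and `q` decays no
faster than a power (`IsNoise.exists_truncation`). (b) Given a jump at `i`, the other summands are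
independent of it and are `o(n)` in probability (`IsNoise.jump_and_rest`). (c) If `S_0^n` is near `𝒜
Z_i` and only one of them is in `n Γ`, then `𝒜 Z_i / n` is near the boundary of `Γ` or `Z_i` is huge
(`IsFailureSet.exists_mismatch_le`). (d) Two large noise vectors at distinct indices of order `n`
are negligible, because `n q(n) → 0` when `α > 1`.

Estimates (b) and (c) give `jump_not_failure_le`; (a) to (c) give `failure_not_jump_le`. With (d),
each of the five quantities is equivalent to `|I_n| p_n`. -/

lemma isOpen_ne_zero_ext {d : ℕ} : IsOpen {x : Fin d → EReal | x ≠ 0} :=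
  isOpen_compl_singleton

instance {d : ℕ} : LocallyCompactSpace (Punctured d) :=
  (isOpen_ne_zero_ext (d := d)).locallyCompactSpace

instance {d : ℕ} : SecondCountableTopology (Punctured d) :=
  inferInstanceAs (SecondCountableTopology {x : Fin d → EReal | x ≠ 0})

instance {d : ℕ} : TopologicalSpace.MetrizableSpace (Punctured d) :=
  TopologicalSpace.metrizableSpace_of_t3_secondCountable _

instance {d : ℕ} : BorelSpace (Punctured d) :=
  inferInstanceAs (BorelSpace {x : Fin d → EReal | x ≠ 0})

/-- The tail function `u ↦ P(‖Y‖ > u)`. -/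
noncomputable def tail {Ω : Type*} [MeasurableSpace Ω] {d : ℕ} (P : Measure Ω) (Y : Ω → Vec d)
    (u : ℝ) : ℝ := P.real {ω | u < ‖Y ω‖}

variable {Ω : Type*} [MeasurableSpace Ω] {d : ℕ} {P : Measure Ω} [IsProbabilityMeasure P]
  {Y : Ω → Vec d} {ν : Measure (Punctured d)} {α : ℝ}

lemma tail_nonneg (u : ℝ) : 0 ≤ tail P Y u := measureReal_nonneg

lemma tail_anti : Antitone (tail P Y) := fun _ _ h =>
  measureReal_mono fun _ hω => lt_of_le_of_lt h hω

lemma continuous_toExt : Continuous (toExt : Vec d → Fin d → EReal) := by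
  unfold toExt
  refine continuous_pi fun i => continuous_coe_real_ereal.comp ?_
  fun_prop

lemma toExt_injective : Function.Injective (toExt : Vec d → Fin d → EReal) := by
  intro x y h
  ext i
  exact EReal.coe_injective (congrFun h i)

lemma toExt_zero : toExt (0 : Vec d) = 0 := by
  funext i; simp [toExt]

lemma toExt_eq_zero {y : Vec d} : toExt y = 0 ↔ y = 0 := by
  rw [← toExt_zero, toExt_injective.eq_iff]

instance isFiniteMeasure_scaledLaw (u : ℝ) : IsFiniteMeasure (scaledLaw P Y u) := by
  refine ⟨?_⟩
  have he : MeasurableEmbedding (Subtype.val : Punctured d → Fin d → EReal) :=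
    MeasurableEmbedding.subtype_coe isOpen_ne_zero_ext.measurableSet
  rw [scaledLaw, he.comap_apply]
  exact measure_lt_top _ _

lemma scaledLaw_extSet (hY : Measurable Y) (u : ℝ) {G : Set (Vec d)} (hG : (0 : Vec d) ∉ G)
    (hm : MeasurableSet (extSet G)) :
    (scaledLaw P Y u).real (extSet G) = P.real {ω | u⁻¹ • Y ω ∈ G} := by
  rw [Measure.real, scaledLaw_apply P hY u hm, Measure.real]
  congr 2
  ext ω
  simp only [extSet, Set.mem_ofPred_eq]
  constructor
  · rintro ⟨x, ⟨y, hy, hyx⟩, hx⟩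
    rw [← hyx] at hx
    rwa [← toExt_injective hx]
  · intro h
    exact ⟨⟨toExt (u⁻¹ • Y ω), fun h0 => hG (toExt_eq_zero.1 h0 ▸ h)⟩, ⟨_, h, rfl⟩, rfl⟩

/-- If the tail vanished from `u` on, the quotients in `vague` would be divisions by zero, hence
`0`, and every test function would have `ν`-integral `0`, contradicting `ν ≠ 0`. -/
lemma IsRegularlyVarying.tail_pos (h : IsRegularlyVarying P Y ν α) (u : ℝ) :
    0 < tail P Y u := by
  have := h.radon
  by_contra hu
  have hz : ∀ v, u ≤ v → tail P Y v = 0 := fun v hv =>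
    le_antisymm ((tail_anti hv).trans (not_lt.1 hu)) (tail_nonneg v)
  have hpos : 0 < ν Set.univ := by
    rw [pos_iff_ne_zero, Ne, Measure.measure_univ_eq_zero]; exact h.ne_zero
  obtain ⟨K, -, hK, hνK⟩ := isOpen_univ.exists_lt_isCompact hpos
  obtain ⟨f, hf1, -, hfc, hf⟩ := exists_continuous_one_zero_of_isCompact hK isClosed_empty
    (Set.disjoint_empty K)
  have hlim := h.vague f f.continuous hfc
  have h0 : ∫ x, f x ∂ν = 0 := by
    refine tendsto_nhds_unique hlim ?_
    refine tendsto_const_nhds.congr' ?_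
    filter_upwards [eventually_ge_atTop u] with v hv
    have := hz v hv
    rw [tail] at this
    rw [this, div_zero]
  have hle : ν.real K ≤ ∫ x, f x ∂ν := by
    rw [← integral_indicator_one hK.measurableSet]
    refine integral_mono_of_nonneg (ae_of_all _ fun x => ?_)
      (f.continuous.integrable_of_hasCompactSupport hfc) (ae_of_all _ fun x => ?_)
    · exact Set.indicator_nonneg (fun _ _ => zero_le_one) x
    · by_cases hx : x ∈ K
      · simp [hx, hf1 hx]
      · simp [hx, (hf x).1]
  have : 0 < ν.real K := ENNReal.toReal_pos hνK.ne' hK.measure_lt_top.ne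
  linarith

/-- Upper bound for compact sets in the vague convergence. -/
lemma IsRegularlyVarying.eventually_compact_le (h : IsRegularlyVarying P Y ν α)
    {K : Set (Punctured d)} (hK : IsCompact K) {r : ℝ} (hr : ν.real K < r) :
    ∀ᶠ u in atTop, (scaledLaw P Y u).real K ≤ r * tail P Y u := by
  have := h.radon
  have hνK : ν K < ENNReal.ofReal r := by
    rw [← ENNReal.ofReal_toReal hK.measure_lt_top.ne]
    exact (ENNReal.ofReal_lt_ofReal_iff (measureReal_nonneg.trans_lt hr)).2 hr
  obtain ⟨U, hKU, hU, hνU⟩ := hK.exists_isOpen_lt_of_lt _ hνK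
  obtain ⟨f, hf1, hf0, hfc, hf⟩ := exists_continuous_one_zero_of_isCompact hK hU.isClosed_compl
    (Set.disjoint_compl_right_iff_subset.2 hKU)
  have hlim := h.vague f f.continuous hfc
  have hfν : ∫ x, f x ∂ν < r := by
    have h1 : ∫ x, f x ∂ν ≤ ν.real U := by
      rw [← integral_indicator_one hU.measurableSet]
      refine integral_mono_of_nonneg (ae_of_all _ fun x => (hf x).1) ?_ (ae_of_all _ fun x => ?_)
      · rw [integrable_indicator_iff hU.measurableSet]
        exact integrableOn_const (hνU.trans ENNReal.ofReal_lt_top).ne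
      · by_cases hx : x ∈ U
        · simp [hx, (hf x).2]
        · simp [hx, hf0 (Set.mem_compl hx)]
    refine h1.trans_lt ?_
    have h2 := ENNReal.toReal_strict_mono ENNReal.ofReal_ne_top hνU
    rwa [ENNReal.toReal_ofReal (measureReal_nonneg.trans hr.le)] at h2
  filter_upwards [hlim.eventually_lt_const hfν] with u hu
  have hpos := h.tail_pos u
  have h3 : (∫ x, f x ∂(scaledLaw P Y u)) < r * tail P Y u := by
    exact (div_lt_iff₀ hpos).1 hu
  refine le_trans ?_ h3.le
  rw [← integral_indicator_one hK.measurableSet]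
  refine integral_mono_of_nonneg (ae_of_all _ fun x => ?_)
    (f.continuous.integrable_of_hasCompactSupport hfc) (ae_of_all _ fun x => ?_)
  · exact Set.indicator_nonneg (fun _ _ => zero_le_one) x
  · by_cases hx : x ∈ K
    · simp [hx, hf1 hx]
    · simp [hx, (hf x).1]

/-- Lower bound for open sets in the vague convergence. -/
lemma IsRegularlyVarying.eventually_le_open (h : IsRegularlyVarying P Y ν α)
    {U : Set (Punctured d)} (hU : IsOpen U) (hpos : 0 < ν U) :
    ∃ m : ℝ, 0 < m ∧ ∀ᶠ u in atTop, m * tail P Y u ≤ (scaledLaw P Y u).real U := by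
  have := h.radon
  obtain ⟨K, hKU, hK, hνK⟩ := hU.exists_lt_isCompact hpos
  obtain ⟨f, hf1, hf0, hfc, hf⟩ := exists_continuous_one_zero_of_isCompact hK hU.isClosed_compl
    (Set.disjoint_compl_right_iff_subset.2 hKU)
  have hlim := h.vague f f.continuous hfc
  have hle : ν.real K ≤ ∫ x, f x ∂ν := by
    rw [← integral_indicator_one hK.measurableSet]
    refine integral_mono_of_nonneg (ae_of_all _ fun x => ?_)
      (f.continuous.integrable_of_hasCompactSupport hfc) (ae_of_all _ fun x => ?_)
    · exact Set.indicator_nonneg (fun _ _ => zero_le_one) x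
    · by_cases hx : x ∈ K
      · simp [hx, hf1 hx]
      · simp [hx, (hf x).1]
  have hK0 : 0 < ν.real K := ENNReal.toReal_pos hνK.ne' hK.measure_lt_top.ne
  refine ⟨ν.real K / 2, by positivity, ?_⟩
  filter_upwards [hlim.eventually_const_lt (show ν.real K / 2 < ∫ x, f x ∂ν by linarith)]
    with u hu
  have htail := h.tail_pos u
  have h3 : ν.real K / 2 * tail P Y u < ∫ x, f x ∂(scaledLaw P Y u) := by
    exact (lt_div_iff₀ htail).1 hu
  refine h3.le.trans ?_
  rw [← integral_indicator_one hU.measurableSet]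
  refine integral_mono_of_nonneg (ae_of_all _ fun x => (hf x).1) ?_ (ae_of_all _ fun x => ?_)
  · rw [integrable_indicator_iff hU.measurableSet]
    exact integrableOn_const (measure_lt_top _ _).ne
  · by_cases hx : x ∈ U
    · simp [hx, (hf x).2]
    · simp [hx, hf0 (Set.mem_compl hx)]

/-- The complement of an open cube, in the compactified punctured space. -/
def outside (d : ℕ) (c : ℝ) : Set (Punctured d) :=
  {x | ∃ i, (c : EReal) ≤ x.1 i ∨ x.1 i ≤ ((-c : ℝ) : EReal)}

lemma isCompact_outside {c : ℝ} (hc : 0 < c) : IsCompact (outside d c) := by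
  rw [Subtype.isCompact_iff]
  have : (Subtype.val '' outside d c) =
      ⋃ i, {x : Fin d → EReal | (c : EReal) ≤ x i ∨ x i ≤ ((-c : ℝ) : EReal)} := by
    ext x
    simp only [outside, Set.mem_image, Set.mem_ofPred_eq, Set.mem_iUnion]
    constructor
    · rintro ⟨y, hy, rfl⟩; exact hy
    · rintro ⟨i, hi⟩
      refine ⟨⟨x, ?_⟩, ⟨i, hi⟩, rfl⟩
      rintro rfl
      rcases hi with hi | hi
      · have : c ≤ 0 := EReal.coe_le_coe_iff.1 hi
        linarith
      · have : (0 : ℝ) ≤ -c := EReal.coe_le_coe_iff.1 hi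
        linarith
  rw [this]
  refine (isClosed_iUnion_of_finite fun i => ?_).isCompact
  exact (isClosed_le continuous_const (continuous_apply i)).union
    (isClosed_le (continuous_apply i) continuous_const)

/-- Puts the sets `outside d c` in the scope of homogeneity, so that their `ν`-measure is an
explicit multiple of `c ^ (-α)`. -/
lemma outside_eq_dilate {c : ℝ} (hc : 0 < c) : outside d c = dilate c (outside d 1) := by
  have hcc : ∀ x : EReal, (c : EReal) * (((c⁻¹ : ℝ) : EReal) * x) = x := fun x => by
    rw [← mul_assoc, ← EReal.coe_mul, mul_inv_cancel₀ hc.ne', EReal.coe_one, one_mul]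
  have hcc' : ∀ x : EReal, ((c⁻¹ : ℝ) : EReal) * ((c : EReal) * x) = x := fun x => by
    rw [← mul_assoc, ← EReal.coe_mul, inv_mul_cancel₀ hc.ne', EReal.coe_one, one_mul]
  have hc0 : (0 : EReal) ≤ (c : EReal) := by exact_mod_cast hc.le
  have hc0' : (0 : EReal) ≤ ((c⁻¹ : ℝ) : EReal) := by exact_mod_cast (inv_pos.2 hc).le
  have h1 : (c : EReal) * ((1 : ℝ) : EReal) = c := by rw [← EReal.coe_mul, mul_one]
  have h2 : (c : EReal) * ((-1 : ℝ) : EReal) = ((-c : ℝ) : EReal) := by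
    rw [← EReal.coe_mul]; congr 1; ring
  have h1' : ((c⁻¹ : ℝ) : EReal) * (c : EReal) = ((1 : ℝ) : EReal) := by
    rw [← EReal.coe_mul, inv_mul_cancel₀ hc.ne']
  have h2' : ((c⁻¹ : ℝ) : EReal) * ((-c : ℝ) : EReal) = ((-1 : ℝ) : EReal) := by
    rw [← EReal.coe_mul]; congr 1; field_simp
  ext x
  simp only [outside, dilate, Set.mem_ofPred_eq]
  constructor
  · rintro ⟨i, hi⟩
    refine ⟨⟨fun j => ((c⁻¹ : ℝ) : EReal) * x.1 j, fun h0 => x.2 ?_⟩, ⟨i, ?_⟩, ?_⟩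
    · funext j
      rw [← hcc (x.1 j), show ((c⁻¹ : ℝ) : EReal) * x.1 j = 0 from congrFun h0 j, mul_zero]; rfl
    · rcases hi with hi | hi
      · left; rw [← h1']; exact mul_le_mul_of_nonneg_left hi hc0'
      · right; rw [← h2']; exact mul_le_mul_of_nonneg_left hi hc0'
    · funext j; exact (hcc _).symm
  · rintro ⟨y, ⟨i, hi⟩, hx⟩
    refine ⟨i, ?_⟩
    rw [hx]
    rcases hi with hi | hi
    · left; simpa only [h1] using mul_le_mul_of_nonneg_left hi hc0
    · right; simpa only [h2] using mul_le_mul_of_nonneg_left hi hc0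

lemma exists_coord_ge {y : Vec d} {c : ℝ} (hc : 0 < c) (hy : c < ‖y‖) :
    ∃ i, c / d ≤ |y i| := by
  by_contra! hcon
  have h1 : ‖y‖ ≤ ∑ i, |y i| := by
    have : y = ∑ i, EuclideanSpace.single i (y i) := by
      ext j; simp
    calc ‖y‖ = ‖∑ i, EuclideanSpace.single i (y i)‖ := by rw [← this]
      _ ≤ ∑ i, ‖(EuclideanSpace.single i (y i) : Vec d)‖ := norm_sum_le _ _
      _ = ∑ i, |y i| := by simp
  have h2 : ∑ i, |y i| ≤ ∑ _i : Fin d, c / d := Finset.sum_le_sum fun i _ => (hcon i).le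
  rw [Finset.sum_const, Finset.card_univ, Fintype.card_fin, nsmul_eq_mul] at h2
  have h3 : (d : ℝ) * (c / d) ≤ c := by
    rcases eq_or_ne (d : ℝ) 0 with h0 | h0
    · simp [h0, hc.le]
    · rw [mul_div_cancel₀ _ h0]
  linarith

/-- In dimension zero the punctured space is empty and carries no nonzero measure. -/
lemma IsRegularlyVarying.dim_pos (h : IsRegularlyVarying P Y ν α) : 0 < d := by
  rcases Nat.eq_zero_or_pos d with h0 | h0
  · subst h0
    have : IsEmpty (Punctured 0) := ⟨fun x => x.2 (Subsingleton.elim _ _)⟩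
    exact absurd (Measure.eq_zero_of_isEmpty ν) h.ne_zero
  · exact h0

/-- The event `‖Y‖ > c u` puts `Y / u` in the compact set `outside d (c / d)`, of measure
proportional to `c ^ (-α)`. The constant `Λ` does not depend on `c`, which is what the Potter bounds
need. -/
lemma IsRegularlyVarying.tail_mul_le (h : IsRegularlyVarying P Y ν α) (hY : Measurable Y) :
    ∃ Λ : ℝ, 0 < Λ ∧ ∀ c : ℝ, 0 < c → ∀ᶠ u in atTop, tail P Y (c * u) ≤
      Λ * c ^ (-α) * tail P Y u := by
  have := h.radon
  have hd : (0 : ℝ) < d := by exact_mod_cast h.dim_pos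
  set κ := ν.real (outside d 1)
  have hκ : 0 ≤ κ := measureReal_nonneg
  refine ⟨(κ + 1) * (1 / d : ℝ) ^ (-α), by positivity, fun c hc => ?_⟩
  have hcd : 0 < c / d := by positivity
  have hval : ν.real (outside d (c / d)) = (c / d) ^ (-α) * κ := by
    rw [outside_eq_dilate hcd, Measure.real,
      h.homogeneous _ hcd _ (isCompact_outside one_pos).measurableSet, ENNReal.toReal_mul,
      ENNReal.toReal_ofReal (by positivity)]
    rfl
  have hlt : ν.real (outside d (c / d)) < (κ + 1) * (1 / d : ℝ) ^ (-α) * c ^ (-α) := by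
    rw [hval, mul_assoc, ← Real.mul_rpow (by positivity) hc.le, mul_comm,
      show (1 / d * c : ℝ) = c / d by ring]
    have : 0 < (c / d) ^ (-α) := by positivity
    nlinarith
  filter_upwards [h.eventually_compact_le (isCompact_outside hcd) hlt, eventually_gt_atTop 0]
    with u hu hu0
  refine le_trans ?_ hu
  rw [Measure.real, scaledLaw_apply P hY u (isCompact_outside hcd).measurableSet, tail]
  refine measureReal_mono fun ω hω => ?_
  simp only [Set.mem_ofPred_eq] at hω ⊢
  have hn : c < ‖u⁻¹ • Y ω‖ := by
    rw [norm_smul, norm_inv, Real.norm_of_nonneg hu0.le, lt_inv_mul_iff₀ hu0]; linarith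
  obtain ⟨i, hi⟩ := exists_coord_ge hc hn
  refine ⟨⟨toExt (u⁻¹ • Y ω), fun h0 => ?_⟩, ⟨i, ?_⟩, rfl⟩
  · rw [toExt_eq_zero.1 h0, norm_zero] at hn; linarith
  · rcases le_abs.1 hi with hi | hi
    · left; exact EReal.coe_le_coe_iff.2 hi
    · right; exact EReal.coe_le_coe_iff.2 (by linarith)

lemma isCompact_extSet {G : Set (Vec d)} (hG : IsCompact G) (h0 : (0 : Vec d) ∉ G) :
    IsCompact (extSet G) := by
  rw [Subtype.isCompact_iff]
  convert hG.image continuous_toExt using 1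
  ext x
  simp only [extSet, Set.mem_image, Set.mem_ofPred_eq]
  constructor
  · rintro ⟨y, ⟨z, hz, hzy⟩, rfl⟩; exact ⟨z, hz, hzy⟩
  · rintro ⟨z, hz, rfl⟩
    exact ⟨⟨toExt z, fun h => h0 (toExt_eq_zero.1 h ▸ hz)⟩, ⟨z, hz, rfl⟩, rfl⟩

lemma isOpen_extSet {G : Set (Vec d)} (hG : IsOpen G) : IsOpen (extSet G) := by
  have hopen : Topology.IsOpenEmbedding (fun y : Fin d → ℝ => fun i => ((y i : ℝ) : EReal)) := by
    refine ⟨⟨?_, ?_⟩, ?_⟩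
    · exact Topology.IsInducing.piMap fun _ => EReal.isEmbedding_coe.isInducing
    · intro x y hxy; funext i; exact EReal.coe_injective (congrFun hxy i)
    · have : Set.range (fun y : Fin d → ℝ => fun i => ((y i : ℝ) : EReal)) =
          Set.pi Set.univ fun _ => Set.range ((↑) : ℝ → EReal) := by
        ext x
        simp only [Set.mem_range, Set.mem_pi, Set.mem_univ, forall_true_left]
        constructor
        · rintro ⟨y, rfl⟩ i; exact ⟨y i, rfl⟩
        · intro hx; choose y hy using hx; exact ⟨y, funext hy⟩
      rw [this]
      exact isOpen_set_pi Set.finite_univ fun _ _ => EReal.isOpenEmbedding_coe.isOpen_range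
  have hcomp := hopen.comp (PiLp.homeomorph 2 (fun _ : Fin d => ℝ)).isOpenEmbedding
  have := hcomp.isOpenMap G hG
  have h2 := this.preimage (continuous_subtype_val (p := fun x : Fin d → EReal => x ≠ 0))
  convert h2 using 1
  ext x
  simp only [extSet, Set.mem_ofPred_eq, Set.mem_preimage, Set.mem_image]
  rfl

/-- As the boundary is null, the open set `T ⁻¹' interior Γ` already has positive measure, and the
open-set lower bound applies to it. -/
lemma IsRegularlyVarying.eventually_le_failure (h : IsRegularlyVarying P Y ν α)
    (hY : Measurable Y) (T : Vec d →L[ℝ] Vec d) {Γ : Set (Vec d)} (h0 : (0 : Vec d) ∉ Γ)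
    (hpos : 0 < ν (extSet (T ⁻¹' Γ))) (hfr : ν (extSet (T ⁻¹' frontier Γ)) = 0) :
    ∃ m : ℝ, 0 < m ∧ ∀ᶠ u in atTop, m * tail P Y u ≤ P.real {ω | u⁻¹ • Y ω ∈ T ⁻¹' Γ} := by
  have hU : IsOpen (T ⁻¹' interior Γ) := isOpen_interior.preimage T.continuous
  have hU0 : (0 : Vec d) ∉ T ⁻¹' interior Γ := fun hx => h0 <| by
    have := interior_subset hx; rwa [map_zero] at this
  have hle : ν (extSet (T ⁻¹' Γ)) ≤ ν (extSet (T ⁻¹' interior Γ)) := by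
    refine (measure_mono (t := extSet (T ⁻¹' interior Γ) ∪ extSet (T ⁻¹' frontier Γ)) ?_).trans
      ((measure_union_le _ _).trans (by rw [hfr, add_zero]))
    rintro x ⟨y, hy, hyx⟩
    by_cases hi : T y ∈ interior Γ
    · exact Or.inl ⟨y, hi, hyx⟩
    · exact Or.inr ⟨y, ⟨subset_closure hy, hi⟩, hyx⟩
  obtain ⟨m, hm, hev⟩ := h.eventually_le_open (isOpen_extSet hU) (hpos.trans_le hle)
  refine ⟨m, hm, hev.mono fun u hu => hu.trans ?_⟩
  rw [scaledLaw_extSet hY u hU0 (isOpen_extSet hU).measurableSet]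
  exact measureReal_mono fun ω hω => interior_subset (s := Γ) hω

/-- Closed neighbourhoods of the boundary, cut off at radius `R`, are compact and decrease to a
`ν`-null set; continuity from above makes one of them small. The cutoff is needed because
thickenings are taken in `ℝ^d`, not in the compactification. -/
lemma IsRegularlyVarying.eventually_frontier_le (h : IsRegularlyVarying P Y ν α)
    (hY : Measurable Y) (T : Vec d →L[ℝ] Vec d) {Γ : Set (Vec d)} {δ₀ : ℝ} (hδ : 0 < δ₀)
    (hΓ : Γ ⊆ (Metric.closedBall (0 : Vec d) δ₀)ᶜ)
    (hfr : ν (extSet (T ⁻¹' frontier Γ)) = 0) (R : ℝ) {η : ℝ} (hη : 0 < η) :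
    ∃ ε : ℝ, 0 < ε ∧ ∀ᶠ u in atTop, P.real {ω | ‖u⁻¹ • Y ω‖ ≤ R ∧
      T (u⁻¹ • Y ω) ∈ Metric.cthickening ε (frontier Γ)} ≤ η * tail P Y u := by
  have := h.radon
  -- Radii below `δ₀` keep the origin out of every thickening.
  obtain ⟨e, he0, hemono, he1, helim⟩ : ∃ e : ℕ → ℝ, (∀ k, 0 < e k) ∧ Antitone e ∧ e 0 < δ₀ ∧
      Tendsto e atTop (𝓝 0) := by
    refine ⟨fun k => δ₀ / 2 * (1 / ((k : ℝ) + 1)), fun k => by positivity, fun j k hjk => ?_, ?_,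
      ?_⟩
    · dsimp only; gcongr
    · norm_num; linarith
    · simpa using tendsto_one_div_add_atTop_nhds_zero_nat.const_mul (δ₀ / 2)
  set G : ℕ → Set (Vec d) := fun k =>
    Metric.closedBall 0 R ∩ T ⁻¹' Metric.cthickening (e k) (frontier Γ) with hG
  have hGc : ∀ k, IsCompact (G k) := fun k =>
    (isCompact_closedBall 0 R).inter_right (Metric.isClosed_cthickening.preimage T.continuous)
  have hfar : ∀ y ∈ frontier Γ, δ₀ ≤ ‖y‖ := by
    have hcl : IsClosed {y : Vec d | δ₀ ≤ ‖y‖} := isClosed_le continuous_const continuous_norm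
    have hsub : Γ ⊆ {y : Vec d | δ₀ ≤ ‖y‖} := fun y hy => by
      have := hΓ hy
      simp only [Set.mem_compl_iff, mem_closedBall_zero_iff, not_le] at this
      exact this.le
    exact fun y hy => closure_minimal hsub hcl (frontier_subset_closure hy)
  have hG0 : ∀ k, (0 : Vec d) ∉ G k := by
    rintro k ⟨-, hk⟩
    rw [Set.mem_preimage, map_zero, Metric.mem_cthickening_iff] at hk
    have h1 : ENNReal.ofReal δ₀ ≤ Metric.infEDist (0 : Vec d) (frontier Γ) := by
      refine Metric.le_infEDist.2 fun y hy => ?_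
      rw [edist_dist, dist_zero_left]
      exact ENNReal.ofReal_le_ofReal (hfar y hy)
    have h2 := (ENNReal.ofReal_le_ofReal_iff (he0 k).le).1 (h1.trans hk)
    have h3 : e k ≤ e 0 := hemono (Nat.zero_le k)
    linarith
  have hKc : ∀ k, IsCompact (extSet (G k)) := fun k => isCompact_extSet (hGc k) (hG0 k)
  have hinter : ⋂ k, extSet (G k) ⊆ extSet (T ⁻¹' frontier Γ) := by
    intro x hx
    rw [Set.mem_iInter] at hx
    obtain ⟨y, hy, hyx⟩ := hx 0
    have hyk : ∀ k, y ∈ G k := fun k => by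
      obtain ⟨z, hz, hzx⟩ := hx k
      rwa [toExt_injective (hyx.trans hzx.symm)]
    refine ⟨y, ?_, hyx⟩
    rw [Set.mem_preimage, ← isClosed_frontier.closure_eq, Metric.mem_closure_iff_infEDist_zero]
    refine le_antisymm ?_ bot_le
    have hl : Tendsto (fun k => ENNReal.ofReal (e k)) atTop (𝓝 0) := by
      have hc := (ENNReal.continuous_ofReal.tendsto 0).comp helim
      rw [ENNReal.ofReal_zero] at hc
      exact hc
    exact ge_of_tendsto' hl fun k => Metric.mem_cthickening_iff.1 (hyk k).2
  have hGanti : ∀ j k, j ≤ k → G k ⊆ G j := fun j k hjk =>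
    Set.inter_subset_inter_right _ (Set.preimage_mono (Metric.cthickening_mono (hemono hjk) _))
  have hanti : Antitone fun k => extSet (G k) := by
    rintro j k hjk x ⟨y, hy, hyx⟩
    exact ⟨y, hGanti j k hjk hy, hyx⟩
  have hlim := tendsto_measure_iInter_atTop (μ := ν)
    (fun k => (hKc k).measurableSet.nullMeasurableSet) hanti ⟨0, (hKc 0).measure_lt_top.ne⟩
  rw [measure_mono_null hinter hfr] at hlim
  obtain ⟨k, hk⟩ := (hlim.eventually_lt_const (ENNReal.ofReal_pos.2 hη)).exists
  refine ⟨e k, he0 k, ?_⟩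
  have hk' : ν.real (extSet (G k)) < η := by
    have h2 := ENNReal.toReal_strict_mono ENNReal.ofReal_ne_top hk
    rwa [ENNReal.toReal_ofReal hη.le] at h2
  filter_upwards [h.eventually_compact_le (hKc k) hk'] with u hu
  rw [scaledLaw_extSet hY u (hG0 k) (hKc k).measurableSet] at hu
  convert hu using 4
  simp [hG]

end RegularVariation

/-! ### Potter type bounds for the tail -/

section Potter

/-- Giving up `α - s` in the exponent absorbs `Λ` for one large ratio `r`. Iterating along powers of
`r` and interpolating by monotonicity costs only the factor `r ^ s`. -/
lemma exists_potter_bound {q : ℝ → ℝ} (hq : Antitone q) (hq0 : ∀ u, 0 ≤ q u) {Λ α s : ℝ}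
    (hΛ : ∀ c : ℝ, 0 < c → ∀ᶠ u in atTop, q (c * u) ≤ Λ * c ^ (-α) * q u)
    (hs : 0 < s) (hsα : s < α) :
    ∃ D u₀ : ℝ, 0 < D ∧ 0 < u₀ ∧ ∀ u, u₀ ≤ u → ∀ x, 1 ≤ x → q (x * u) ≤ D * x ^ (-s) * q u := by
  obtain ⟨r, hr⟩ := (((tendsto_rpow_atTop (sub_pos.2 hsα)).eventually_ge_atTop Λ).and
    (eventually_ge_atTop (2 : ℝ))).exists
  obtain ⟨hrΛ, hr2⟩ := hr
  have hr0 : 0 < r := by linarith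
  have hkey : Λ * r ^ (-α) ≤ r ^ (-s) := by
    calc Λ * r ^ (-α) ≤ r ^ (α - s) * r ^ (-α) := by gcongr
      _ = r ^ (-s) := by rw [← Real.rpow_add hr0]; congr 1; ring
  obtain ⟨v, hv⟩ := eventually_atTop.1 (hΛ r hr0)
  have hit : ∀ k : ℕ, ∀ u, max v 1 ≤ u → q (r ^ k * u) ≤ (r ^ k) ^ (-s) * q u := by
    intro k
    induction k with
    | zero => intro u _; simp
    | succ k ih =>
      intro u hu
      have hrk : 1 ≤ r ^ k := one_le_pow₀ (by linarith)
      have hu1 : 1 ≤ u := (le_max_right _ _).trans hu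
      have hu' : v ≤ r ^ k * u := by nlinarith [le_max_left v 1]
      calc q (r ^ (k + 1) * u) = q (r * (r ^ k * u)) := by congr 1; ring
        _ ≤ Λ * r ^ (-α) * q (r ^ k * u) := hv _ hu'
        _ ≤ r ^ (-s) * ((r ^ k) ^ (-s) * q u) := by
            gcongr
            · exact hq0 _
            · exact ih u hu
        _ = (r ^ (k + 1)) ^ (-s) * q u := by
            rw [pow_succ, Real.mul_rpow (by positivity) hr0.le]; ring
  refine ⟨r ^ s, max v 1, by positivity, by positivity, fun u hu x hx => ?_⟩
  obtain ⟨k, hk1, hk2⟩ := exists_nat_pow_near hx (show 1 < r by linarith)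
  have hu1 : 1 ≤ u := (le_max_right _ _).trans hu
  have hx0 : 0 < x := by linarith
  calc q (x * u) ≤ q (r ^ k * u) := hq (by gcongr)
    _ ≤ (r ^ k) ^ (-s) * q u := hit k u hu
    _ ≤ (x / r) ^ (-s) * q u := by
        refine mul_le_mul_of_nonneg_right ?_ (hq0 u)
        refine Real.rpow_le_rpow_of_nonpos (by positivity) ?_ (by linarith)
        rw [div_le_iff₀ hr0, ← pow_succ]; exact hk2.le
    _ = r ^ s * x ^ (-s) * q u := by
        rw [div_eq_mul_inv, Real.mul_rpow hx0.le (by positivity), Real.inv_rpow hr0.le,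
          Real.rpow_neg hr0.le s, inv_inv]; ring

/-- Doubling the argument divides `q` by at most `2 ^ κ`, so `q` decays at most polynomially. One
extra power of `n` absorbs the constants. -/
lemma exists_pow_inv_le {q : ℝ → ℝ} (hq : Antitone q) (hq0 : ∀ u, 0 < q u) {Λ α : ℝ}
    (hΛ : ∀ c : ℝ, 0 < c → ∀ᶠ u in atTop, q (c * u) ≤ Λ * c ^ (-α) * q u) :
    ∃ κ : ℕ, ∀ᶠ n : ℕ in atTop, ((n : ℝ) ^ κ)⁻¹ ≤ q n := by
  obtain ⟨κ, hκ⟩ := pow_unbounded_of_one_lt (Λ * (1 / 2 : ℝ) ^ (-α)) one_lt_two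
  obtain ⟨v, hv⟩ := eventually_atTop.1 (hΛ (1 / 2) (by norm_num))
  set w := max v 1
  have hw1 : 1 ≤ w := le_max_right _ _
  have hit : ∀ k : ℕ, q w ≤ ((2 : ℝ) ^ k) ^ κ * q (2 ^ k * w) := by
    intro k
    induction k with
    | zero => simp
    | succ k ih =>
      have hk : 1 ≤ (2 : ℝ) ^ (k + 1) := one_le_pow₀ (by norm_num)
      have hv' : v ≤ 2 ^ (k + 1) * w := by nlinarith [le_max_left v 1]
      have h1 : q (2 ^ k * w) ≤ 2 ^ κ * q (2 ^ (k + 1) * w) := by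
        have := hv _ hv'
        rw [show (1 / 2 : ℝ) * (2 ^ (k + 1) * w) = 2 ^ k * w by ring] at this
        refine this.trans ?_
        gcongr
        exact (hq0 _).le
      calc q w ≤ ((2 : ℝ) ^ k) ^ κ * q (2 ^ k * w) := ih
        _ ≤ ((2 : ℝ) ^ k) ^ κ * (2 ^ κ * q (2 ^ (k + 1) * w)) := by gcongr
        _ = _ := by ring
  refine ⟨κ + 1, ?_⟩
  filter_upwards [tendsto_natCast_atTop_atTop.eventually_ge_atTop w,
    tendsto_natCast_atTop_atTop.eventually_ge_atTop (2 ^ κ / q w)] with n hn1 hn2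
  have hn0 : 0 < (n : ℝ) := by linarith
  have hx : 1 ≤ (n : ℝ) / w := (one_le_div (by linarith)).2 hn1
  obtain ⟨k, hk1, hk2⟩ := exists_nat_pow_near hx (show (1 : ℝ) < 2 by norm_num)
  have h1 : q (2 ^ (k + 1) * w) ≤ q n := by
    refine hq ?_
    rw [div_lt_iff₀ (by linarith)] at hk2
    exact hk2.le
  have h2 : ((2 : ℝ) ^ (k + 1)) ≤ 2 * n := by
    rw [pow_succ, mul_comm]
    have : (n : ℝ) / w ≤ n := div_le_self hn0.le hw1
    linarith
  have h3 : q w ≤ (2 * n) ^ κ * q n := (hit (k + 1)).trans <| by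
    gcongr
    exact (hq0 _).le
  rw [div_le_iff₀ (hq0 w)] at hn2
  have h4 : (2 : ℝ) ^ κ ≤ 2 ^ κ * (n ^ (κ + 1) * q n) := by
    calc (2 : ℝ) ^ κ ≤ n * q w := hn2
      _ ≤ n * ((2 * n) ^ κ * q n) := by gcongr
      _ = _ := by rw [mul_pow]; ring
  have h5 : 1 ≤ (n : ℝ) ^ (κ + 1) * q n := by
    have h2κ : (0 : ℝ) < 2 ^ κ := by positivity
    nlinarith
  rw [inv_le_iff_one_le_mul₀ (by positivity)]
  linarith

variable {Ω : Type*} [MeasurableSpace Ω] {d : ℕ} {P : Measure Ω} [IsProbabilityMeasure P]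
  {Y : Ω → Vec d}

lemma integrable_norm_rpow_of_tail_le (hY : Measurable Y) {c s s' t₀ : ℝ} (hs' : 0 < s')
    (hs : s' < s) (ht : 0 < t₀) (hc : 0 ≤ c) (h : ∀ t, t₀ ≤ t → tail P Y t ≤ c * t ^ (-s)) :
    Integrable (fun ω => ‖Y ω‖ ^ s') P := by
  have hmeas : Measurable fun ω => ‖Y ω‖ ^ s' := hY.norm.pow_const _
  refine ⟨hmeas.aestronglyMeasurable, ?_⟩
  rw [hasFiniteIntegral_iff_ofReal (ae_of_all _ fun ω => by positivity),
    lintegral_rpow_eq_lintegral_meas_lt_mul P (ae_of_all _ fun ω => norm_nonneg _)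
      hY.norm.aemeasurable hs']
  refine ENNReal.mul_lt_top ENNReal.ofReal_lt_top ?_
  rw [← Set.Ioc_union_Ioi_eq_Ioi ht.le]
  refine (lintegral_union_le _ _ _).trans_lt (ENNReal.add_lt_top.2 ⟨?_, ?_⟩)
  · have hint : IntegrableOn (fun t : ℝ => t ^ (s' - 1)) (Set.Ioc 0 t₀) :=
      (intervalIntegrable_iff_integrableOn_Ioc_of_le ht.le).1
        (intervalIntegral.intervalIntegrable_rpow' (by linarith))
    refine lt_of_le_of_lt (lintegral_mono fun t => ?_) hint.lintegral_lt_top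
    exact mul_le_of_le_one_left' prob_le_one
  · have hint : IntegrableOn (fun t : ℝ => c * t ^ (s' - 1 - s)) (Set.Ioi t₀) :=
      (integrableOn_Ioi_rpow_of_lt (by linarith) ht).const_mul c
    refine lt_of_le_of_lt (setLIntegral_mono' measurableSet_Ioi fun t ht' => ?_)
      hint.lintegral_lt_top
    have ht0 : 0 < t := ht.trans ht'
    have h1 : P {a | t < ‖Y a‖} ≤ ENNReal.ofReal (c * t ^ (-s)) := by
      rw [← ofReal_measureReal]
      exact ENNReal.ofReal_le_ofReal (h t (le_of_lt ht'))
    calc P {a | t < ‖Y a‖} * ENNReal.ofReal (t ^ (s' - 1))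
        ≤ ENNReal.ofReal (c * t ^ (-s)) * ENNReal.ofReal (t ^ (s' - 1)) := by gcongr
      _ = ENNReal.ofReal (c * t ^ (s' - 1 - s)) := by
          rw [← ENNReal.ofReal_mul (by positivity), mul_assoc, ← Real.rpow_add ht0]
          congr 3; ring

end Potter

/-- The quantitative consequences of regular variation with exponent `> 1` that enter the
estimates for sums. -/
structure HeavyTail {Ω : Type*} [MeasurableSpace Ω] {d : ℕ} (P : Measure Ω) (Y : Ω → Vec d) :
    Prop where
  tail_pos : ∀ u, 0 < tail P Y u
  tail_mul_le : ∀ c : ℝ, 0 < c → ∃ D : ℝ, 0 < D ∧ ∀ᶠ n : ℕ in atTop,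
    tail P Y (c * n) ≤ D * tail P Y n
  tail_small : ∀ η : ℝ, 0 < η → ∃ R : ℝ, 0 < R ∧ ∀ᶠ n : ℕ in atTop,
    tail P Y (R * n) ≤ η * tail P Y n
  moment : ∃ s : ℝ, 1 < s ∧ s ≤ 2 ∧ Integrable (fun ω => ‖Y ω‖ ^ s) P
  pow_inv_le : ∃ κ : ℕ, ∀ᶠ n : ℕ in atTop, ((n : ℝ) ^ κ)⁻¹ ≤ tail P Y n
  mul_tail : Tendsto (fun n : ℕ => n * tail P Y n) atTop (𝓝 0)
  tail_clm : ∀ C δ : ℝ, 0 < C → 0 < δ → ∃ D : ℝ, 0 < D ∧ ∀ᶠ n : ℕ in atTop,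
    ∀ B : Vec d →L[ℝ] Vec d, ‖B‖ ≤ C →
      P.real {ω | δ * n < ‖B (Y ω)‖} ≤ D * ‖B‖ * tail P Y n

lemma IsRegularlyVarying.heavyTail {Ω : Type*} [MeasurableSpace Ω] {d : ℕ} {P : Measure Ω}
    [IsProbabilityMeasure P] {Y : Ω → Vec d} {ν : Measure (Punctured d)} {α : ℝ}
    (h : IsRegularlyVarying P Y ν α) (hY : Measurable Y) (hα : 1 < α) : HeavyTail P Y := by
  obtain ⟨Λ, hΛ0, hΛ⟩ := h.tail_mul_le hY
  -- Exponents `1 < s' < s < min α 2`: `s` serves the Potter bound, and the smaller `s'` has a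
  -- finite moment.
  set a := min α 2
  have ha1 : 1 < a := lt_min hα (by norm_num)
  have haα : a ≤ α := min_le_left _ _
  have ha2 : a ≤ 2 := min_le_right _ _
  obtain ⟨s, h1s, hsa⟩ := exists_between ha1
  obtain ⟨s', h1s', hs's⟩ := exists_between h1s
  have hcast := tendsto_natCast_atTop_atTop (R := ℝ)
  have hmul : ∀ c : ℝ, 0 < c → ∃ D : ℝ, 0 < D ∧ ∀ᶠ n : ℕ in atTop,
      tail P Y (c * n) ≤ D * tail P Y n := fun c hc =>
    ⟨Λ * c ^ (-α), by positivity, hcast.eventually (hΛ c hc)⟩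
  obtain ⟨D, u₀, hD, hu₀, hpot⟩ := exists_potter_bound (tail_anti (P := P) (Y := Y))
    (fun u => tail_nonneg u) hΛ (show 0 < s by linarith) (by linarith)
  have hdecay : ∀ t, u₀ ≤ t → tail P Y t ≤ D * u₀ ^ s * tail P Y u₀ * t ^ (-s) := by
    intro t ht
    have hx : 1 ≤ t / u₀ := (one_le_div hu₀).2 ht
    have := hpot u₀ le_rfl _ hx
    rw [div_mul_cancel₀ _ hu₀.ne'] at this
    refine this.trans_eq ?_
    rw [div_eq_mul_inv, Real.mul_rpow (by linarith) (by positivity), Real.inv_rpow hu₀.le,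
      Real.rpow_neg hu₀.le s, inv_inv]
    ring
  refine ⟨h.tail_pos, hmul, ?_, ?_, ?_, ?_, ?_⟩
  · intro η hη
    have hlim : Tendsto (fun R : ℝ => Λ * R ^ (-α)) atTop (𝓝 0) := by
      simpa using (tendsto_rpow_neg_atTop (by linarith : 0 < α)).const_mul Λ
    obtain ⟨R, hR, hR0⟩ := ((hlim.eventually_lt_const hη).and (eventually_gt_atTop 0)).exists
    refine ⟨R, hR0, (hcast.eventually (hΛ R hR0)).mono fun n hn => hn.trans ?_⟩
    exact mul_le_mul_of_nonneg_right hR.le (tail_nonneg _)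
  · refine ⟨s', h1s', by linarith, ?_⟩
    exact integrable_norm_rpow_of_tail_le hY (by linarith) hs's hu₀
      (mul_nonneg (by positivity) (tail_nonneg _)) hdecay
  · exact exists_pow_inv_le tail_anti h.tail_pos hΛ
  · set c := D * u₀ ^ s * tail P Y u₀
    have hlim : Tendsto (fun n : ℕ => c * (n : ℝ) ^ (-(s - 1))) atTop (𝓝 0) := by
      simpa using ((tendsto_rpow_neg_atTop (by linarith : 0 < s - 1)).comp hcast).const_mul c
    refine squeeze_zero' (Eventually.of_forall fun n => mul_nonneg n.cast_nonneg (tail_nonneg _))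
      ?_ hlim
    filter_upwards [hcast.eventually_ge_atTop u₀] with n hn
    have hn0 : (0 : ℝ) < n := by linarith
    calc (n : ℝ) * tail P Y n ≤ n * (c * (n : ℝ) ^ (-s)) := by gcongr; exact hdecay _ hn
      _ = c * ((n : ℝ) ^ (1 : ℝ) * (n : ℝ) ^ (-s)) := by rw [Real.rpow_one]; ring
      _ = c * (n : ℝ) ^ (-(s - 1)) := by rw [← Real.rpow_add hn0]; congr 2; ring
  · intro C δ hC hδ
    obtain ⟨D', hD', hev⟩ := hmul (δ / C) (by positivity)
    refine ⟨D / C * D', by positivity, ?_⟩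
    filter_upwards [hev, hcast.eventually_ge_atTop (u₀ * C / δ), eventually_gt_atTop 0]
      with n hn hn1 hn0 B hB
    have hn0' : (0 : ℝ) < n := by exact_mod_cast hn0
    rcases (norm_nonneg B).eq_or_lt with hb | hb
    · have : {ω | δ * n < ‖B (Y ω)‖} = ∅ := by
        ext ω
        simp only [Set.mem_ofPred_eq, Set.mem_empty_iff_false, iff_false, not_lt]
        have := B.le_opNorm (Y ω)
        rw [← hb, zero_mul] at this
        exact this.trans (by positivity)
      rw [this, ← hb]; simp
    · have hx : 1 ≤ C / ‖B‖ := (one_le_div hb).2 hB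
      have hu : u₀ ≤ δ / C * n := by
        rw [div_le_iff₀ hδ] at hn1
        rw [div_mul_eq_mul_div, le_div_iff₀ hC]; linarith
      calc P.real {ω | δ * n < ‖B (Y ω)‖} ≤ tail P Y (C / ‖B‖ * (δ / C * n)) := by
            refine measureReal_mono fun ω hω => ?_
            simp only [Set.mem_ofPred_eq] at hω ⊢
            have h2 := hω.trans_le (B.le_opNorm (Y ω))
            rw [show C / ‖B‖ * (δ / C * n) = δ * n / ‖B‖ by field_simp, div_lt_iff₀ hb]
            linarith
        _ ≤ D * (C / ‖B‖) ^ (-s) * tail P Y (δ / C * n) := hpot _ hu _ hx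
        -- Since `C / ‖B‖ ≥ 1` and `s > 1`, the exponent may be weakened to `-1`. The bound becomes
        -- linear in `‖B‖` and can be summed over the weights.
        _ ≤ D * (C / ‖B‖) ^ (-1 : ℝ) * (D' * tail P Y n) := by
            gcongr
            exact tail_nonneg _
        _ = D / C * D' * ‖B‖ * tail P Y n := by
            rw [Real.rpow_neg_one, inv_div]; ring

/-! ### Sums of independent vectors without large summands -/

section TruncatedSums

variable {Ω : Type*} [MeasurableSpace Ω] {d : ℕ} {P : Measure Ω} [IsProbabilityMeasure P]

lemma exp_le_one_add_add_sq (x : ℝ) : Real.exp x ≤ 1 + x + x ^ 2 * Real.exp |x| := by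
  have h := Complex.norm_exp_sub_sum_le_norm_mul_exp (x : ℂ) 2
  have h1 : Complex.exp (x : ℂ) - ∑ m ∈ Finset.range 2, (x : ℂ) ^ m / (m.factorial : ℂ) =
      ((Real.exp x - (1 + x) : ℝ) : ℂ) := by
    simp [Finset.sum_range_succ]
  rw [h1, Complex.norm_real, Complex.norm_real, Real.norm_eq_abs, Real.norm_eq_abs, sq_abs] at h
  linarith [le_abs_self (Real.exp x - (1 + x))]

/-- The linear functional `l` of the vector `y`, set to zero if `‖y‖ > a`. -/
noncomputable def truncated (l : Vec d →L[ℝ] ℝ) (a : ℝ) (y : Vec d) : ℝ :=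
  {y : Vec d | ‖y‖ ≤ a}.indicator l y

lemma measurable_truncated (l : Vec d →L[ℝ] ℝ) (a : ℝ) : Measurable (truncated l a) :=
  l.continuous.measurable.indicator (measurableSet_le measurable_norm measurable_const)

/-- The coefficient in the bound for exponential moments of truncated vectors. -/
noncomputable def expCoeff (s a t : ℝ) : ℝ :=
  t * a ^ (1 - s) + t ^ 2 * a ^ (2 - s) * Real.exp (t * a)

lemma expCoeff_nonneg {s a t : ℝ} (ha : 0 ≤ a) (ht : 0 ≤ t) : 0 ≤ expCoeff s a t := by
  unfold expCoeff; positivity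

/-- The linear term involves the untruncated `l y`, so zero mean removes it after integration and
the truncation need not be recentred. Where `‖y‖ > a`, the term `t * a ^ (1 - s) * ‖y‖ ^ s`
compensates for a negative `t * l y`. -/
lemma exp_truncated_le {l : Vec d →L[ℝ] ℝ} (hl : ∀ y, |l y| ≤ ‖y‖) {s a t : ℝ} (hs1 : 1 < s)
    (hs2 : s ≤ 2) (ha : 0 < a) (ht : 0 ≤ t) (y : Vec d) :
    Real.exp (t * truncated l a y) ≤ 1 + t * l y + expCoeff s a t * ‖y‖ ^ s := by
  have h1 : 0 ≤ t * a ^ (1 - s) * ‖y‖ ^ s := by positivity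
  have h2 : 0 ≤ t ^ 2 * a ^ (2 - s) * Real.exp (t * a) * ‖y‖ ^ s := by positivity
  by_cases hy : ‖y‖ ≤ a
  · have htr : truncated l a y = l y := Set.indicator_of_mem (s := {y : Vec d | ‖y‖ ≤ a}) hy _
    rw [htr]
    refine (exp_le_one_add_add_sq _).trans ?_
    have hsq : (t * l y) ^ 2 ≤ t ^ 2 * (a ^ (2 - s) * ‖y‖ ^ s) := by
      rw [mul_pow]
      gcongr
      calc l y ^ 2 = |l y| ^ 2 := (sq_abs _).symm
        _ ≤ ‖y‖ ^ 2 := by gcongr; exact hl y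
        _ = ‖y‖ ^ (2 - s) * ‖y‖ ^ s := by
            rw [← Real.rpow_add' (norm_nonneg y) (by norm_num), ← Real.rpow_natCast]
            norm_num
        _ ≤ a ^ (2 - s) * ‖y‖ ^ s := by
            gcongr
    have habs : |t * l y| ≤ t * a := by
      rw [abs_mul, abs_of_nonneg ht]
      gcongr
      exact (hl y).trans hy
    have : (t * l y) ^ 2 * Real.exp |t * l y| ≤
        t ^ 2 * (a ^ (2 - s) * ‖y‖ ^ s) * Real.exp (t * a) := by gcongr
    unfold expCoeff
    linarith
  · have htr : truncated l a y = 0 := Set.indicator_of_notMem (s := {y : Vec d | ‖y‖ ≤ a}) hy _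
    rw [htr, mul_zero, Real.exp_zero]
    have hya : a < ‖y‖ := not_le.1 hy
    have hy0 : 0 < ‖y‖ := ha.trans hya
    have h3 : ‖y‖ ≤ a ^ (1 - s) * ‖y‖ ^ s := by
      calc ‖y‖ = ‖y‖ ^ (1 - s) * ‖y‖ ^ s := by
            rw [← Real.rpow_add hy0]; simp
        _ ≤ a ^ (1 - s) * ‖y‖ ^ s := by
            gcongr ?_ * _
            exact Real.rpow_le_rpow_of_nonpos ha hya.le (by linarith)
    have h4 : -‖y‖ ≤ l y := (abs_le.1 (hl y)).1
    have h5 : 0 ≤ t * (l y + a ^ (1 - s) * ‖y‖ ^ s) := mul_nonneg ht (by linarith)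
    unfold expCoeff
    linarith

lemma integrable_exp_truncated {Y : Ω → Vec d} (hY : Measurable Y) {l : Vec d →L[ℝ] ℝ}
    (hl : ∀ y, |l y| ≤ ‖y‖) {a : ℝ} (ha : 0 ≤ a) {t : ℝ} (ht : 0 ≤ t) :
    Integrable (fun ω => Real.exp (t * truncated l a (Y ω))) P := by
  refine Integrable.of_bound (C := Real.exp (t * a)) ?_ (ae_of_all _ fun ω => ?_)
  · exact (Real.measurable_exp.comp
      (((measurable_truncated l a).comp hY).const_mul t)).aestronglyMeasurable
  · rw [Real.norm_of_nonneg (Real.exp_pos _).le]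
    gcongr
    by_cases hy : ‖Y ω‖ ≤ a
    · rw [truncated, Set.indicator_of_mem (s := {y : Vec d | ‖y‖ ≤ a}) hy]
      exact (le_abs_self _).trans ((hl _).trans hy)
    · rwa [truncated, Set.indicator_of_notMem (s := {y : Vec d | ‖y‖ ≤ a}) hy]

lemma mgf_truncated_le {Y : Ω → Vec d} (hY : Measurable Y) (hint : Integrable Y P)
    (hmean : ∫ ω, Y ω ∂P = 0) {l : Vec d →L[ℝ] ℝ} (hl : ∀ y, |l y| ≤ ‖y‖) {s a t : ℝ}
    (hs1 : 1 < s) (hs2 : s ≤ 2) (hs : Integrable (fun ω => ‖Y ω‖ ^ s) P) (ha : 0 < a)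
    (ht : 0 ≤ t) :
    mgf (fun ω => truncated l a (Y ω)) P t ≤
      Real.exp (expCoeff s a t * ∫ ω, ‖Y ω‖ ^ s ∂P) := by
  have hlint : Integrable (fun ω => l (Y ω)) P := l.integrable_comp hint
  have hl0 : ∫ ω, l (Y ω) ∂P = 0 := by
    rw [l.integral_comp_comm hint, hmean, map_zero]
  have hi1 : Integrable (fun ω => 1 + t * l (Y ω)) P :=
    (integrable_const 1).add (hlint.const_mul t)
  calc mgf (fun ω => truncated l a (Y ω)) P t
      ≤ ∫ ω, (1 + t * l (Y ω) + expCoeff s a t * ‖Y ω‖ ^ s) ∂P :=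
        integral_mono (integrable_exp_truncated hY hl ha.le ht) (hi1.add (hs.const_mul _))
          fun ω => exp_truncated_le hl hs1 hs2 ha ht (Y ω)
    _ = expCoeff s a t * (∫ ω, ‖Y ω‖ ^ s ∂P) + 1 := by
        rw [integral_add hi1 (hs.const_mul _),
          integral_add (integrable_const 1) (hlint.const_mul t), integral_const_mul,
          integral_const_mul, hl0]
        simp [add_comm]
    _ ≤ _ := Real.add_one_le_exp _

/-- The choice of the parameter in the exponential Markov inequality. -/
lemma exists_chernoff_parameter {s Q ε : ℝ} (hs : 1 < s) (hε : 0 < ε) (κ : ℕ) :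
    ∃ δ : ℝ, 0 < δ ∧ ∀ᶠ n : ℕ in atTop, ∃ t : ℝ, 0 ≤ t ∧
      Real.exp (-t * (ε * n)) * Real.exp (expCoeff s (δ * n) t * (Q * n)) ≤
        ((n : ℝ) ^ κ)⁻¹ := by
  -- With `t = L log n / n` the Markov factor is `n ^ (-(κ + 1))`. The choice of `δ` makes `exp (t δ
  -- n) = n ^ ((s - 1) / 2)`, so the other exponent is `log n` times a null sequence and costs at
  -- most one power of `n`.
  set L : ℝ := (κ + 1) / ε with hL
  have hL0 : 0 < L := by positivity
  set δ : ℝ := (s - 1) / 2 / L with hδ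
  have hδ0 : 0 < δ := div_pos (by linarith) hL0
  refine ⟨δ, hδ0, ?_⟩
  have hcast := tendsto_natCast_atTop_atTop (R := ℝ)
  have hlim : Tendsto (fun x : ℝ => Q * (L * δ ^ (1 - s) * x ^ (-(s - 1)) +
      L ^ 2 * δ ^ (2 - s) * (Real.log x * x ^ (-((s - 1) / 2))))) atTop (𝓝 0) := by
    have h1 : Tendsto (fun x : ℝ => x ^ (-(s - 1))) atTop (𝓝 0) :=
      tendsto_rpow_neg_atTop (by linarith)
    have h2 : Tendsto (fun x : ℝ => Real.log x * x ^ (-((s - 1) / 2))) atTop (𝓝 0) := by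
      have := (isLittleO_log_rpow_atTop (show 0 < (s - 1) / 2 by linarith)).tendsto_div_nhds_zero
      refine this.congr' ?_
      filter_upwards [eventually_ge_atTop 0] with x hx
      rw [Real.rpow_neg hx, div_eq_mul_inv]
    simpa using ((h1.const_mul (L * δ ^ (1 - s))).add
      (h2.const_mul (L ^ 2 * δ ^ (2 - s)))).const_mul Q
  filter_upwards [(hlim.comp hcast).eventually_lt_const one_pos, eventually_gt_atTop 1]
    with n hn hn1
  have hn1' : (1 : ℝ) < n := by exact_mod_cast hn1
  have hn0 : (0 : ℝ) < n := by linarith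
  have hlog : 0 < Real.log n := Real.log_pos hn1'
  refine ⟨L * Real.log n / n, by positivity, ?_⟩
  have e1 : -(L * Real.log n / n) * (ε * n) = -((κ + 1) * Real.log n) := by
    rw [hL]; field_simp
  have e2 : expCoeff s (δ * n) (L * Real.log n / n) * (Q * n) = Real.log n *
      (Q * (L * δ ^ (1 - s) * (n : ℝ) ^ (-(s - 1)) +
      L ^ 2 * δ ^ (2 - s) * (Real.log n * (n : ℝ) ^ (-((s - 1) / 2))))) := by
    have hexp : Real.exp (L * Real.log n / n * (δ * n)) = (n : ℝ) ^ ((s - 1) / 2) := by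
      rw [Real.rpow_def_of_pos hn0, hδ]; congr 1; field_simp
    have hp1 : (n : ℝ) ^ (1 - s) = (n : ℝ) ^ (-(s - 1)) := by congr 1; ring
    have hp2 : (n : ℝ) ^ (2 - s) * (n : ℝ) ^ ((s - 1) / 2) =
        n * (n : ℝ) ^ (-((s - 1) / 2)) := by
      rw [← Real.rpow_add hn0]
      nth_rewrite 2 [← Real.rpow_one (n : ℝ)]
      rw [← Real.rpow_add hn0]; congr 1; ring
    rw [expCoeff, hexp, Real.mul_rpow hδ0.le hn0.le, Real.mul_rpow hδ0.le hn0.le, hp1]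
    calc _ = Q * (L * Real.log n * (δ ^ (1 - s) * (n : ℝ) ^ (-(s - 1)))) * (n / n) +
          Q * (L ^ 2 * Real.log n ^ 2 * δ ^ (2 - s) *
            ((n : ℝ) ^ (2 - s) * (n : ℝ) ^ ((s - 1) / 2))) * (n / n) / n := by
            field_simp
      _ = _ := by rw [hp2, div_self hn0.ne']; field_simp
  rw [e1, e2, ← Real.exp_add]
  have hfin : -((κ + 1) * Real.log n) + Real.log n * (Q * (L * δ ^ (1 - s) *
      (n : ℝ) ^ (-(s - 1)) + L ^ 2 * δ ^ (2 - s) * (Real.log n * (n : ℝ) ^ (-((s - 1) / 2))))) ≤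
      -(κ * Real.log n) := by
    have := mul_le_mul_of_nonneg_left hn.le hlog.le
    simp only [Function.comp_apply] at this
    linarith
  refine (Real.exp_le_exp.2 hfin).trans_eq ?_
  rw [Real.exp_neg, ← Real.log_pow, Real.exp_log (by positivity)]

end TruncatedSums

/-! ### Weighted sums of the noise -/

section WeightedSums

variable {Ω : Type*} [MeasurableSpace Ω] {d : ℕ} {P : Measure Ω} [IsProbabilityMeasure P]
  {Z : ℤ → Ω → Vec d} {ν : Measure (Punctured d)} {α : ℝ}

lemma IsNoise.heavyTail (hZ : IsNoise P Z ν α) : HeavyTail P (Z 0) :=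
  hZ.regVar.heavyTail (hZ.measurable 0) hZ.one_lt

omit [IsProbabilityMeasure P] in
lemma IsNoise.prob_eq (hZ : IsNoise P Z ν α) (i : ℤ) {s : Set (Vec d)} (hs : MeasurableSet s) :
    P.real {ω | Z i ω ∈ s} = P.real {ω | Z 0 ω ∈ s} := by
  rw [Measure.real, Measure.real]
  exact congrArg _ ((hZ.identDistrib i).measure_mem_eq hs)

/-- The weights `B` have norms at most `C`, with sum at most `C n`. -/
def WeightBound (C : ℝ) (n : ℕ) (B : ℤ → Vec d →L[ℝ] Vec d) : Prop :=
  (∀ j, ‖B j‖ ≤ C) ∧ ∀ F : Finset ℤ, ∑ j ∈ F, ‖B j‖ ≤ C * n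

omit [IsProbabilityMeasure P] in
-- From `‖B j‖ ^ s ≤ C ^ (s - 1) * ‖B j‖`, the total moment is `O(n)` uniformly in `F`.
lemma IsNoise.sum_moment_le (hZ : IsNoise P Z ν α) {s : ℝ} (hs : 1 < s)
    (hm : Integrable (fun ω => ‖Z 0 ω‖ ^ s) P) {C : ℝ} (hC : 0 < C) {n : ℕ}
    {B : ℤ → Vec d →L[ℝ] Vec d} (hB : WeightBound C n B) (F : Finset ℤ) :
    (∀ j, Integrable (fun ω => ‖B j (Z j ω)‖ ^ s) P) ∧
    ∑ j ∈ F, ∫ ω, ‖B j (Z j ω)‖ ^ s ∂P ≤ C ^ s * (∫ ω, ‖Z 0 ω‖ ^ s ∂P) * n := by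
  have hid : ∀ j, IdentDistrib (fun ω => ‖Z j ω‖ ^ s) (fun ω => ‖Z 0 ω‖ ^ s) P P := fun j =>
    (hZ.identDistrib j).comp (u := fun y : Vec d => ‖y‖ ^ s) (measurable_norm.pow_const s)
  have hmj : ∀ j, Integrable (fun ω => ‖Z j ω‖ ^ s) P := fun j => (hid j).integrable_iff.2 hm
  have hle : ∀ j ω, ‖B j (Z j ω)‖ ^ s ≤ ‖B j‖ ^ s * ‖Z j ω‖ ^ s := fun j ω => by
    rw [← Real.mul_rpow (norm_nonneg _) (norm_nonneg _)]
    exact Real.rpow_le_rpow (norm_nonneg _) ((B j).le_opNorm _) (by linarith)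
  have hint : ∀ j, Integrable (fun ω => ‖B j (Z j ω)‖ ^ s) P := fun j => by
    refine ((hmj j).const_mul (‖B j‖ ^ s)).mono' ?_ (ae_of_all _ fun ω => ?_)
    · exact ((((B j).continuous.measurable.comp (hZ.measurable j)).norm).pow_const
        s).aestronglyMeasurable
    · rw [Real.norm_of_nonneg (by positivity)]
      exact hle j ω
  refine ⟨hint, ?_⟩
  set μ := ∫ ω, ‖Z 0 ω‖ ^ s ∂P
  have hμ : 0 ≤ μ := integral_nonneg fun ω => by positivity
  have hone : ∀ j, ∫ ω, ‖B j (Z j ω)‖ ^ s ∂P ≤ C ^ (s - 1) * ‖B j‖ * μ := fun j => by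
    calc ∫ ω, ‖B j (Z j ω)‖ ^ s ∂P ≤ ∫ ω, ‖B j‖ ^ s * ‖Z j ω‖ ^ s ∂P :=
          integral_mono (hint j) ((hmj j).const_mul _) (hle j)
      _ = ‖B j‖ ^ s * μ := by rw [integral_const_mul, (hid j).integral_eq]
      _ = ‖B j‖ ^ (s - 1) * ‖B j‖ * μ := by
          congr 1
          nth_rewrite 3 [← Real.rpow_one ‖B j‖]
          rw [← Real.rpow_add' (norm_nonneg _) (by linarith)]
          congr 1; ring
      _ ≤ C ^ (s - 1) * ‖B j‖ * μ := by
          gcongr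
          exact hB.1 j
  calc ∑ j ∈ F, ∫ ω, ‖B j (Z j ω)‖ ^ s ∂P ≤ ∑ j ∈ F, C ^ (s - 1) * ‖B j‖ * μ :=
        Finset.sum_le_sum fun j _ => hone j
    _ = C ^ (s - 1) * (∑ j ∈ F, ‖B j‖) * μ := by rw [← Finset.sum_mul, ← Finset.mul_sum]
    _ ≤ C ^ (s - 1) * (C * n) * μ := by gcongr; exact hB.2 F
    _ = C ^ (s - 1) * C ^ (1 : ℝ) * μ * n := by rw [Real.rpow_one]; ring
    _ = C ^ s * μ * n := by rw [← Real.rpow_add hC]; congr 3; ring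

lemma IsNoise.functional_sum_le (hZ : IsNoise P Z ν α) {s : ℝ} (hs1 : 1 < s) (hs2 : s ≤ 2)
    (hm : Integrable (fun ω => ‖Z 0 ω‖ ^ s) P) {C : ℝ} (hC : 0 < C) {n : ℕ}
    {B : ℤ → Vec d →L[ℝ] Vec d} (hB : WeightBound C n B) (F : Finset ℤ)
    {l : Vec d →L[ℝ] ℝ} (hl : ∀ y, |l y| ≤ ‖y‖) {a t : ℝ} (ha : 0 < a) (ht : 0 ≤ t) (x : ℝ) :
    P.real {ω | x ≤ l (∑ j ∈ F, B j (Z j ω)) ∧ ∀ j ∈ F, ‖B j (Z j ω)‖ ≤ a} ≤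
      Real.exp (-t * x) *
        Real.exp (expCoeff s a t * (C ^ s * (∫ ω, ‖Z 0 ω‖ ^ s ∂P) * n)) := by
  set ξ : ℤ → Ω → ℝ := fun j ω => truncated l a (B j (Z j ω)) with hξ
  obtain ⟨hmom, hsum⟩ := hZ.sum_moment_le hs1 hm hC hB F
  have hBm : ∀ j, Measurable fun ω => B j (Z j ω) := fun j =>
    (B j).continuous.measurable.comp (hZ.measurable j)
  have hξm : ∀ j, Measurable (ξ j) := fun j => (measurable_truncated l a).comp (hBm j)
  have hind : iIndepFun ξ P := hZ.indep.comp (fun j y => truncated l a (B j y)) fun j =>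
    (measurable_truncated l a).comp (B j).continuous.measurable
  have hZint : ∀ j, Integrable (Z j) P := fun j => (hZ.identDistrib j).integrable_iff.2 hZ.integrable
  have hmean : ∀ j, ∫ ω, B j (Z j ω) ∂P = 0 := fun j => by
    rw [(B j).integral_comp_comm (hZint j), (hZ.identDistrib j).integral_eq, hZ.mean_zero, map_zero]
  have hexp : Integrable (fun ω => Real.exp (t * (∑ j ∈ F, ξ j) ω)) P :=
    hind.integrable_exp_mul_sum hξm fun j _ => integrable_exp_truncated (hBm j) hl ha.le ht
  calc P.real {ω | x ≤ l (∑ j ∈ F, B j (Z j ω)) ∧ ∀ j ∈ F, ‖B j (Z j ω)‖ ≤ a}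
      ≤ P.real {ω | x ≤ (∑ j ∈ F, ξ j) ω} := by
        refine measureReal_mono fun ω hω => ?_
        obtain ⟨h1, h2⟩ := hω
        simp only [Set.mem_ofPred_eq]
        rw [map_sum] at h1
        rw [Finset.sum_apply]
        refine h1.trans_eq (Finset.sum_congr rfl fun j hj => ?_)
        exact (Set.indicator_of_mem (s := {y : Vec d | ‖y‖ ≤ a}) (h2 j hj) l).symm
    _ ≤ Real.exp (-t * x) * mgf (∑ j ∈ F, ξ j) P t := measure_ge_le_exp_mul_mgf x ht hexp
    _ = Real.exp (-t * x) * ∏ j ∈ F, mgf (ξ j) P t := by rw [hind.mgf_sum hξm]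
    _ ≤ Real.exp (-t * x) * ∏ j ∈ F,
          Real.exp (expCoeff s a t * ∫ ω, ‖B j (Z j ω)‖ ^ s ∂P) := by
        gcongr with j hj
        · exact fun j _ => mgf_nonneg
        · exact mgf_truncated_le (hBm j) ((B j).integrable_comp (hZint j)) (hmean j) hl hs1 hs2
            (hmom j) ha ht
    _ ≤ _ := by
        rw [← Real.exp_sum, ← Finset.mul_sum]
        gcongr
        exact expCoeff_nonneg ha.le ht

/-- A weighted sum of the noise is large without a large summand with small probability only. -/
lemma IsNoise.exists_truncation (hZ : IsNoise P Z ν α) {C ε : ℝ} (hC : 0 < C) (hε : 0 < ε) :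
    ∃ δ : ℝ, 0 < δ ∧ ∀ᶠ n : ℕ in atTop, ∀ B : ℤ → Vec d →L[ℝ] Vec d, WeightBound C n B →
      ∀ F : Finset ℤ, P.real {ω | ε * n < ‖∑ j ∈ F, B j (Z j ω)‖ ∧
        ∀ j ∈ F, ‖B j (Z j ω)‖ ≤ δ * n} ≤ tail P (Z 0) n := by
  obtain ⟨s, hs1, hs2, hm⟩ := hZ.heavyTail.moment
  obtain ⟨κ, hκ⟩ := hZ.heavyTail.pow_inv_le
  have hd : (0 : ℝ) < d := by exact_mod_cast hZ.regVar.dim_pos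
  -- The power `κ + 1` instead of `κ` pays for a union bound over the `2 * d` signed coordinates,
  -- once `n ≥ 2 * d`.
  obtain ⟨δ, hδ, hch⟩ := exists_chernoff_parameter (Q := C ^ s * ∫ ω, ‖Z 0 ω‖ ^ s ∂P) hs1
    (show 0 < ε / d by positivity) (κ + 1)
  refine ⟨δ, hδ, ?_⟩
  filter_upwards [hκ, hch, eventually_ge_atTop (2 * d), eventually_gt_atTop 0]
    with n hn ⟨t, ht, htn⟩ hnd hn0 B hB F
  have hn0' : (0 : ℝ) < n := by exact_mod_cast hn0
  refine le_trans ?_ hn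
  set l : Fin d × Bool → Vec d →L[ℝ] ℝ := fun i =>
    (if i.2 then (1 : ℝ) else -1) • (EuclideanSpace.proj i.1 : Vec d →L[ℝ] ℝ) with hldef
  have hl : ∀ i y, |l i y| ≤ ‖y‖ := by
    rintro ⟨i, b⟩ y
    have : |y i| ≤ ‖y‖ := PiLp.norm_apply_le y i
    cases b <;> simpa [hldef] using this
  have hsub : {ω | ε * n < ‖∑ j ∈ F, B j (Z j ω)‖ ∧ ∀ j ∈ F, ‖B j (Z j ω)‖ ≤ δ * n} ⊆
      ⋃ i ∈ (Finset.univ : Finset (Fin d × Bool)),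
        {ω | ε / d * n ≤ l i (∑ j ∈ F, B j (Z j ω)) ∧ ∀ j ∈ F, ‖B j (Z j ω)‖ ≤ δ * n} := by
    rintro ω ⟨h1, h2⟩
    obtain ⟨i, hi⟩ := exists_coord_ge (by positivity) h1
    rw [mul_div_right_comm] at hi
    simp only [Finset.mem_univ, Set.iUnion_true, Set.mem_iUnion]
    rcases le_abs.1 hi with hi | hi
    · exact ⟨(i, true), by simpa [hldef] using hi, h2⟩
    · exact ⟨(i, false), by simpa [hldef] using hi, h2⟩
  calc _ ≤ _ := measureReal_mono hsub (measure_ne_top _ _)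
    _ ≤ _ := measureReal_biUnion_finset_le _ _
    _ ≤ ∑ _i : Fin d × Bool, ((n : ℝ) ^ (κ + 1))⁻¹ := by
        refine Finset.sum_le_sum fun i _ => le_trans ?_ htn
        exact hZ.functional_sum_le hs1 hs2 hm hC hB F (hl i) (by positivity) ht _
    _ = (2 * d : ℕ) * ((n : ℝ) ^ (κ + 1))⁻¹ := by
        simp [Finset.sum_const, Finset.card_univ, mul_comm]
    _ ≤ n * ((n : ℝ) ^ (κ + 1))⁻¹ := by gcongr
    _ = ((n : ℝ) ^ κ)⁻¹ := by rw [pow_succ]; field_simp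

lemma IsNoise.exists_large_le (hZ : IsNoise P Z ν α) {C δ : ℝ} (hC : 0 < C) (hδ : 0 < δ) :
    ∃ D : ℝ, 0 < D ∧ ∀ᶠ n : ℕ in atTop, ∀ B : Vec d →L[ℝ] Vec d, ‖B‖ ≤ C → ∀ j : ℤ,
      P.real {ω | δ * n < ‖B (Z j ω)‖} ≤ D * ‖B‖ * tail P (Z 0) n := by
  obtain ⟨D, hD, hev⟩ := hZ.heavyTail.tail_clm C δ hC hδ
  refine ⟨D, hD, hev.mono fun n hn B hB j => le_trans (le_of_eq ?_) (hn B hB)⟩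
  exact hZ.prob_eq j (s := {y : Vec d | δ * n < ‖B y‖})
    (measurableSet_lt measurable_const B.continuous.measurable.norm)

/-- The weak law of large numbers, uniformly in the weights. -/
lemma IsNoise.weak_law (hZ : IsNoise P Z ν α) {C ε θ : ℝ} (hC : 0 < C) (hε : 0 < ε)
    (hθ : 0 < θ) :
    ∀ᶠ n : ℕ in atTop, ∀ B : ℤ → Vec d →L[ℝ] Vec d, WeightBound C n B →
      ∀ F : Finset ℤ, P.real {ω | ε * n < ‖∑ j ∈ F, B j (Z j ω)‖} ≤ θ := by
  obtain ⟨δ, hδ, htr⟩ := hZ.exists_truncation hC hε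
  obtain ⟨D, hD, hlarge⟩ := hZ.exists_large_le hC hδ
  have hlim := hZ.heavyTail.mul_tail
  have hlim' : Tendsto (fun n : ℕ => (1 + D * C) * (n * tail P (Z 0) n)) atTop (𝓝 0) := by
    simpa using hlim.const_mul (1 + D * C)
  filter_upwards [htr, hlarge, hlim'.eventually_lt_const hθ, eventually_ge_atTop 1]
    with n h1 h2 h3 hn B hB F
  have hq := tail_nonneg (P := P) (Y := Z 0) n
  have hn' : (1 : ℝ) ≤ n := by exact_mod_cast hn
  have hsub : {ω | ε * n < ‖∑ j ∈ F, B j (Z j ω)‖} ⊆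
      {ω | ε * n < ‖∑ j ∈ F, B j (Z j ω)‖ ∧ ∀ j ∈ F, ‖B j (Z j ω)‖ ≤ δ * n} ∪
      ⋃ j ∈ F, {ω | δ * n < ‖B j (Z j ω)‖} := by
    intro ω hω
    by_cases h : ∀ j ∈ F, ‖B j (Z j ω)‖ ≤ δ * n
    · exact Or.inl ⟨hω, h⟩
    · push Not at h
      obtain ⟨j, hj, hlt⟩ := h
      exact Or.inr (Set.mem_biUnion hj hlt)
  calc _ ≤ _ := measureReal_mono hsub
    _ ≤ _ := measureReal_union_le _ _
    _ ≤ tail P (Z 0) n + ∑ j ∈ F, D * ‖B j‖ * tail P (Z 0) n := by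
        refine add_le_add (h1 B hB F) ((measureReal_biUnion_finset_le _ _).trans ?_)
        exact Finset.sum_le_sum fun j _ => h2 _ (hB.1 j) j
    _ = tail P (Z 0) n + D * (∑ j ∈ F, ‖B j‖) * tail P (Z 0) n := by
        rw [← Finset.sum_mul, ← Finset.mul_sum]
    _ ≤ n * tail P (Z 0) n + D * (C * n) * tail P (Z 0) n := by
        gcongr
        · exact le_mul_of_one_le_left hq hn'
        · exact hB.2 F
    _ = (1 + D * C) * (n * tail P (Z 0) n) := by ring
    _ ≤ θ := h3.le

/-- Passes from finite sums to the full series: the strict inequality `t < ‖W ω‖` persists for all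
late partial sums along a sequence of finite sets, so the event lies a.s. in an increasing union of
sets of measure at most `c`. -/
lemma measureReal_le_of_hasSum {Y : ℤ → Ω → Vec d} {W : Ω → Vec d}
    (h : ∀ᵐ ω ∂P, HasSum (fun j => Y j ω) (W ω)) {A : Set Ω} {t c : ℝ}
    (hc : ∀ F : Finset ℤ, P.real {ω | ω ∈ A ∧ t < ‖∑ j ∈ F, Y j ω‖} ≤ c) :
    P.real {ω | ω ∈ A ∧ t < ‖W ω‖} ≤ c := by
  obtain ⟨F, hF⟩ := exists_seq_tendsto (atTop : Filter (Finset ℤ))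
  set E : ℕ → Set Ω := fun k => {ω | ω ∈ A ∧ t < ‖∑ j ∈ F k, Y j ω‖}
  set G : ℕ → Set Ω := fun m => ⋂ k ≥ m, E k
  have hG : Monotone G := fun m m' hmm => Set.biInter_mono (fun k hk => le_trans hmm hk)
    fun _ _ => le_rfl
  have h0 : 0 ≤ c := measureReal_nonneg.trans (hc ∅)
  refine ENNReal.toReal_le_of_le_ofReal h0 ?_
  calc P {ω | ω ∈ A ∧ t < ‖W ω‖} ≤ P (⋃ m, G m) := by
        refine measure_mono_ae ?_
        filter_upwards [h] with ω hω hmem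
        have hl : Tendsto (fun k => ‖∑ j ∈ F k, Y j ω‖) atTop (𝓝 ‖W ω‖) :=
          (hω.comp hF).norm
        obtain ⟨m, hm⟩ := eventually_atTop.1 (hl.eventually_const_lt hmem.2)
        exact Set.mem_iUnion.2 ⟨m, Set.mem_iInter₂.2 fun k hk => ⟨hmem.1, hm k hk⟩⟩
    _ = ⨆ m, P (G m) := hG.measure_iUnion
    _ ≤ ENNReal.ofReal c := iSup_le fun m => by
        refine (measure_mono (Set.biInter_subset_of_mem (le_refl m))).trans ?_
        rw [← ofReal_measureReal]
        exact ENNReal.ofReal_le_ofReal (hc (F m))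

omit [IsProbabilityMeasure P] in
lemma IsNoise.jump_and_sum (hZ : IsNoise P Z ν α) (B : ℤ → Vec d →L[ℝ] Vec d) {F : Finset ℤ}
    {i : ℤ} (hi : i ∉ F) (c t : ℝ) :
    P.real {ω | c < ‖Z i ω‖ ∧ t < ‖∑ j ∈ F, B j (Z j ω)‖} =
      tail P (Z 0) c * P.real {ω | t < ‖∑ j ∈ F, B j (Z j ω)‖} := by
  -- One independent family containing both the bare `Z i` and the weighted summands.
  set g : ℤ → Vec d → Vec d := fun j y => if j = i then y else B j y
  have hg : ∀ j, Measurable (g j) := fun j => by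
    by_cases h : j = i
    · simp only [g, h, if_true]; exact measurable_id
    · simp only [g, h, if_false]; exact (B j).continuous.measurable
  have hind : iIndepFun (fun j ω => g j (Z j ω)) P := hZ.indep.comp g hg
  have h1 := hind.indepFun_finsetSum_of_notMem (fun j => (hg j).comp (hZ.measurable j)) hi
  have hsum : (∑ j ∈ F, fun ω => g j (Z j ω)) = fun ω => ∑ j ∈ F, B j (Z j ω) := by
    funext ω
    rw [Finset.sum_apply]
    refine Finset.sum_congr rfl fun j hj => ?_
    have : j ≠ i := fun h => hi (h ▸ hj)
    simp [g, this]
  have hgi : (fun ω => g i (Z i ω)) = Z i := by funext ω; simp [g]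
  rw [hsum, hgi] at h1
  have hS : ∀ r : ℝ, MeasurableSet {y : Vec d | r < ‖y‖} := fun r =>
    measurableSet_lt measurable_const measurable_norm
  have h2 := h1.symm.measure_inter_preimage_eq_mul _ _ (hS c) (hS t)
  have h3 : P.real {ω | c < ‖Z i ω‖} = tail P (Z 0) c := hZ.prob_eq i (hS c)
  rw [← h3, Measure.real, Measure.real, Measure.real, ← ENNReal.toReal_mul]
  exact congrArg ENNReal.toReal h2

/-- A large jump at `i` and a large contribution of the other summands. -/
lemma IsNoise.jump_and_rest (hZ : IsNoise P Z ν α) {C ε θ : ℝ} (hC : 0 < C) (hε : 0 < ε)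
    (hθ : 0 < θ) :
    ∀ᶠ n : ℕ in atTop, ∀ B : ℤ → Vec d →L[ℝ] Vec d, WeightBound C n B →
      ∀ W : Ω → Vec d, (∀ᵐ ω ∂P, HasSum (fun j => B j (Z j ω)) (W ω)) → ∀ (i : ℤ) (c : ℝ),
        P.real {ω | c < ‖Z i ω‖ ∧ ε * n < ‖W ω - B i (Z i ω)‖} ≤ tail P (Z 0) c * θ := by
  filter_upwards [hZ.weak_law hC hε hθ] with n hn B hB W hW i c
  have hW' : ∀ᵐ ω ∂P, HasSum (fun j => if j = i then 0 else B j (Z j ω))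
      (W ω - B i (Z i ω)) := by
    filter_upwards [hW] with ω hω
    have h := hω.sub (hasSum_ite_eq i (B i (Z i ω)))
    refine h.congr_fun fun j => ?_
    by_cases hj : j = i
    · subst hj; simp
    · simp [hj]
  refine measureReal_le_of_hasSum (A := {ω | c < ‖Z i ω‖}) hW' fun F => ?_
  have hs : ∀ ω, ∑ j ∈ F, (if j = i then 0 else B j (Z j ω)) =
      ∑ j ∈ F.erase i, B j (Z j ω) := fun ω => by
    rw [← Finset.sum_filter_add_sum_filter_not F (fun j => j = i)]
    rw [Finset.sum_eq_zero (fun j hj => by simp [(Finset.mem_filter.1 hj).2]), zero_add]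
    refine Finset.sum_congr ?_ fun j hj => ?_
    · ext j; simp [and_comm]
    · simp [(Finset.mem_erase.1 hj).1]
  simp only [hs, Set.mem_ofPred_eq]
  rw [hZ.jump_and_sum B (Finset.notMem_erase i F)]
  exact mul_le_mul_of_nonneg_left (hn B hB _) (tail_nonneg _)

end WeightedSums

/-! ### The weights of the noise in the partial sums -/

section Weights

variable {d : ℕ} {A : ℤ → Matrix (Fin d) (Fin d) ℝ}

/-- Summability is known for operators, whereas `coefSum` is a sum of matrices; the inverse linear
isomorphism is continuous in finite dimension and transports the sum. -/
lemma IsCoef.hasSum_op (hA : IsCoef A) : HasSum (fun i => op (A i)) (op (coefSum A)) := by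
  have hs : Summable fun i => op (A i) := hA.summable_norm.of_norm
  set e := (Matrix.toEuclideanCLM (n := Fin d) (𝕜 := ℝ)).toAlgEquiv.toLinearEquiv with he
  have hcont : Continuous (e.symm : (Vec d →L[ℝ] Vec d) →ₗ[ℝ] Matrix (Fin d) (Fin d) ℝ) :=
    LinearMap.continuous_of_finiteDimensional _
  have h1 : HasSum A (e.symm (∑' i, op (A i))) := by
    have := hs.hasSum.map (e.symm : (Vec d →L[ℝ] Vec d) →ₗ[ℝ] Matrix (Fin d) (Fin d) ℝ) hcont
    refine this.congr_fun fun i => ?_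
    exact (e.symm_apply_apply (A i)).symm
  have h2 : op (coefSum A) = ∑' i, op (A i) := by
    rw [coefSum, h1.tsum_eq]
    exact e.apply_symm_apply _
  rw [h2]
  exact hs.hasSum

/-- The weight of `Z_j` in `S_0^n`. -/
noncomputable def weight (A : ℤ → Matrix (Fin d) (Fin d) ℝ) (n : ℕ) (j : ℤ) :
    Vec d →L[ℝ] Vec d := ∑ k ∈ Finset.Ico (0 : ℤ) (0 + n), op (A (k - j))

/-- A bound for the norms of the weights. -/
noncomputable def weightConst (A : ℤ → Matrix (Fin d) (Fin d) ℝ) : ℝ := 1 + ∑' i, ‖op (A i)‖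

lemma weightConst_pos : 0 < weightConst A := by
  have : 0 ≤ ∑' i, ‖op (A i)‖ := tsum_nonneg fun _ => norm_nonneg _
  unfold weightConst; linarith

lemma sum_norm_weight_le (n : ℕ) (F : Finset ℤ) {c : ℝ}
    (h : ∀ k ∈ Finset.Ico (0 : ℤ) (0 + n), ∑ j ∈ F, ‖op (A (k - j))‖ ≤ c) :
    ∑ j ∈ F, ‖weight A n j‖ ≤ c * n := by
  calc ∑ j ∈ F, ‖weight A n j‖
      ≤ ∑ j ∈ F, ∑ k ∈ Finset.Ico (0 : ℤ) (0 + n), ‖op (A (k - j))‖ :=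
        Finset.sum_le_sum fun j _ => norm_sum_le _ _
    _ = ∑ k ∈ Finset.Ico (0 : ℤ) (0 + n), ∑ j ∈ F, ‖op (A (k - j))‖ := Finset.sum_comm
    _ ≤ ∑ k ∈ Finset.Ico (0 : ℤ) (0 + n), c := Finset.sum_le_sum h
    _ = c * n := by simp [mul_comm]

lemma sum_comp_equiv_le_tsum {a : ℤ → ℝ} (ha : Summable a) (h0 : ∀ i, 0 ≤ a i) (e : ℤ ≃ ℤ)
    (F : Finset ℤ) : ∑ j ∈ F, a (e j) ≤ ∑' i, a i := by
  rw [← e.tsum_eq a]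
  exact (e.summable_iff.2 ha).sum_le_tsum F fun _ _ => h0 _

lemma IsCoef.weightBound (hA : IsCoef A) (n : ℕ) :
    WeightBound (weightConst A) n (weight A n) := by
  have h0 : ∀ i, 0 ≤ ‖op (A i)‖ := fun _ => norm_nonneg _
  have hle : ∑' i, ‖op (A i)‖ ≤ weightConst A := by unfold weightConst; linarith
  refine ⟨fun j => ?_, fun F => sum_norm_weight_le n F fun k _ => ?_⟩
  · refine (norm_sum_le _ _).trans (le_trans ?_ hle)
    exact sum_comp_equiv_le_tsum hA.summable_norm h0 (Equiv.subRight j) _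
  · refine le_trans ?_ hle
    exact sum_comp_equiv_le_tsum hA.summable_norm h0 (Equiv.subLeft k) F

/-- Except for boundary effects, the weights of the noise in the window are close to `𝒜` and
the others are negligible. -/
lemma IsCoef.exists_window (hA : IsCoef A) {η : ℝ} (hη : 0 < η) :
    ∃ K : ℕ, ∀ n : ℕ,
      (∀ j : ℤ, K ≤ j → j < n - K → ‖weight A n j - op (coefSum A)‖ ≤ η) ∧
      ∀ F : Finset ℤ, (∀ j ∈ F, ¬ ((K : ℤ) ≤ j ∧ j < n - K)) →
        ∑ j ∈ F, ‖weight A n j‖ ≤ η * n + 4 * K * weightConst A := by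
  -- Off `s` the coefficient norms sum to less than `η`; partial sums containing `s'` are within `η`
  -- of `𝒜`. `K` exceeds `|i|` for every `i` in either set.
  obtain ⟨s, hs⟩ := summable_iff_vanishing_norm.1 hA.summable_norm η hη
  obtain ⟨s', hs'⟩ := eventually_atTop.1
    (hA.hasSum_op.eventually (Metric.closedBall_mem_nhds (op (coefSum A)) hη))
  set K : ℕ := (s ∪ s').sup Int.natAbs + 1 with hK
  have hmem : ∀ i ∈ s ∪ s', -(K : ℤ) < i ∧ i < K := fun i hi => by
    have : i.natAbs ≤ (s ∪ s').sup Int.natAbs := Finset.le_sup (f := Int.natAbs) hi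
    omega
  refine ⟨K, fun n => ⟨fun j hj1 hj2 => ?_, fun F hF => ?_⟩⟩
  · have h1 : weight A n j = ∑ i ∈ (Finset.Ico (0 : ℤ) (0 + n)).image (· - j), op (A i) := by
      rw [Finset.sum_image (fun x _ y _ h => by simpa using h)]
      rfl
    rw [h1, ← dist_eq_norm]
    refine hs' _ fun i hi => ?_
    have := hmem i (Finset.mem_union_right _ hi)
    refine Finset.mem_image.2 ⟨i + j, Finset.mem_Ico.2 ⟨by omega, by omega⟩, by ring⟩
  · have hC := weightConst_pos (A := A)
    -- Indices far outside `[0, n)` meet only coefficients off `s`, giving `η` for each of the `n`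
    -- values of `k`. The remaining ones lie within `K` of an end: at most `4 * K` indices, each
    -- with weight at most `weightConst A`.
    rw [← Finset.sum_filter_not_add_sum_filter F (fun j => -(K : ℤ) ≤ j ∧ j < n + K)]
    refine add_le_add (sum_norm_weight_le n _ fun k hk => ?_) ?_
    · rw [← Finset.sum_image (f := fun i => ‖op (A i)‖) (g := fun j => k - j)
        (fun x _ y _ h => by simpa using h)]
      have hdis : Disjoint ((F.filter fun j => ¬ (-(K : ℤ) ≤ j ∧ j < n + K)).image
          fun j => k - j) s := by
        rw [Finset.disjoint_left]
        intro i hi his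
        obtain ⟨j, hj, rfl⟩ := Finset.mem_image.1 hi
        have h1 := hmem _ (Finset.mem_union_left _ his)
        have h2 := (Finset.mem_filter.1 hj).2
        have h3 := Finset.mem_Ico.1 hk
        omega
      exact (le_abs_self _).trans (hs _ hdis).le
    · have hsub : F.filter (fun j => -(K : ℤ) ≤ j ∧ j < n + K) ⊆
          Finset.Ico (-(K : ℤ)) K ∪ Finset.Ico ((n : ℤ) - K) (n + K) := by
        intro j hj
        have h1 := hF j (Finset.mem_filter.1 hj).1
        have h2 := (Finset.mem_filter.1 hj).2
        rw [Finset.mem_union, Finset.mem_Ico, Finset.mem_Ico]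
        omega
      have hcard : (F.filter (fun j => -(K : ℤ) ≤ j ∧ j < n + K)).card ≤ 4 * K := by
        refine (Finset.card_le_card hsub).trans ((Finset.card_union_le _ _).trans ?_)
        rw [Int.card_Ico, Int.card_Ico]
        omega
      calc _ ≤ ∑ _j ∈ F.filter (fun j => -(K : ℤ) ≤ j ∧ j < n + K), weightConst A :=
            Finset.sum_le_sum fun j _ => (hA.weightBound n).1 j
        _ = ((F.filter (fun j => -(K : ℤ) ≤ j ∧ j < n + K)).card : ℝ) * weightConst A := by
            rw [Finset.sum_const, nsmul_eq_mul]
        _ ≤ ((4 * K : ℕ) : ℝ) * weightConst A := by gcongr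
        _ = 4 * K * weightConst A := by push_cast; ring

lemma IsCoef.hasSum_S {Ω : Type*} [MeasurableSpace Ω] {P : Measure Ω} {Z : ℤ → Ω → Vec d}
    {ν : Measure (Punctured d)} {α : ℝ} (hA : IsCoef A) (hZ : IsNoise P Z ν α) (n : ℕ) :
    ∀ᵐ ω ∂P, HasSum (fun j => weight A n j (Z j ω)) (S A Z 0 n ω) := by
  filter_upwards [ae_summable_X hA hZ] with ω hω
  have h : ∀ k : ℤ, HasSum (fun j => op (A (k - j)) (Z j ω)) (X A Z k ω) := fun k => by
    have := (Equiv.subLeft k).hasSum_iff.2 (hω k).hasSum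
    refine this.congr_fun fun j => ?_
    simp
  refine (hasSum_sum (s := Finset.Ico (0 : ℤ) (0 + n)) fun k _ => h k).congr_fun fun j => ?_
  simp [weight]

end Weights

/-! ### The failure events -/

section FailureEvents

variable {Ω : Type*} [MeasurableSpace Ω] {d : ℕ} {P : Measure Ω} [IsProbabilityMeasure P]
  {A : ℤ → Matrix (Fin d) (Fin d) ℝ} {Z : ℤ → Ω → Vec d} {ν : Measure (Punctured d)} {α : ℝ}
  {Γ : Set (Vec d)}

lemma mem_natCast_smul_iff {n : ℕ} (hn : 0 < n) {Γ : Set (Vec d)} {y : Vec d} :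
    y ∈ (n : ℝ) • Γ ↔ (n : ℝ)⁻¹ • y ∈ Γ :=
  Set.mem_smul_set_iff_inv_smul_mem₀ (Nat.cast_ne_zero.2 hn.ne') _ _

lemma measurableSet_jump (T : Vec d →L[ℝ] Vec d) (hΓ : MeasurableSet Γ) {n : ℕ} (hn : 0 < n) :
    MeasurableSet {y : Vec d | T y ∈ (n : ℝ) • Γ} :=
  T.continuous.measurable (hΓ.const_smul_of_ne_zero (Nat.cast_ne_zero.2 hn.ne'))

omit [IsProbabilityMeasure P] in
lemma IsNoise.prob_pair (hZ : IsNoise P Z ν α) {i j : ℤ} (hij : i ≠ j) {s t : Set (Vec d)}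
    (hs : MeasurableSet s) (ht : MeasurableSet t) :
    P.real {ω | Z i ω ∈ s ∧ Z j ω ∈ t} = P.real {ω | Z 0 ω ∈ s} * P.real {ω | Z 0 ω ∈ t} := by
  rw [← hZ.prob_eq i hs, ← hZ.prob_eq j ht, Measure.real, Measure.real, Measure.real,
    ← ENNReal.toReal_mul]
  exact congrArg ENNReal.toReal
    ((hZ.indep.indepFun hij).measure_inter_preimage_eq_mul _ _ hs ht)

lemma IsFailureSet.exists_jump_const (hΓ : IsFailureSet A ν Γ) :
    ∃ δ₀ c : ℝ, 0 < δ₀ ∧ 0 < c ∧ Γ ⊆ (Metric.closedBall (0 : Vec d) δ₀)ᶜ ∧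
      (∀ n : ℕ, 0 < n → ∀ y : Vec d, y ∈ (n : ℝ) • Γ → δ₀ * n < ‖y‖) ∧
      ∀ n : ℕ, 0 < n → ∀ y : Vec d, op (coefSum A) y ∈ (n : ℝ) • Γ → c * n < ‖y‖ := by
  obtain ⟨δ₀, hδ, hsub⟩ := hΓ.bounded_away
  have h1 : ∀ n : ℕ, 0 < n → ∀ y : Vec d, y ∈ (n : ℝ) • Γ → δ₀ * n < ‖y‖ := by
    intro n hn y hy
    have hn' : (0 : ℝ) < n := by exact_mod_cast hn
    have := hsub ((mem_natCast_smul_iff hn).1 hy)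
    rw [Set.mem_compl_iff, mem_closedBall_zero_iff, not_le, norm_smul, norm_inv,
      Real.norm_of_nonneg hn'.le, lt_inv_mul_iff₀ hn'] at this
    linarith
  refine ⟨δ₀, δ₀ / (‖op (coefSum A)‖ + 1), hδ, by positivity, hsub, h1, fun n hn y hy => ?_⟩
  have h2 := (h1 n hn _ hy).trans_le ((op (coefSum A)).le_opNorm y)
  rw [div_mul_eq_mul_div, div_lt_iff₀ (by positivity)]
  nlinarith [norm_nonneg y, norm_nonneg (op (coefSum A))]

/-- Otherwise the interior and the exterior of `Γ` would disconnect `s`. It is used for the segment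
between two nearby points. -/
lemma inter_frontier_nonempty {s : Set (Vec d)} (hs : IsPreconnected s)
    (h1 : (s ∩ Γ).Nonempty) (h2 : ∃ w ∈ s, w ∉ Γ) : (s ∩ frontier Γ).Nonempty := by
  by_contra hne
  have hout : ∀ y ∈ s, y ∉ frontier Γ := fun y hy hf => hne ⟨y, hy, hf⟩
  obtain ⟨x, hx, hxΓ⟩ := h1
  obtain ⟨w, hw, hwΓ⟩ := h2
  have hsub : s ⊆ interior Γ ∪ (closure Γ)ᶜ := fun y hy => by
    by_contra h
    rw [Set.mem_union, not_or, Set.mem_compl_iff, not_not] at h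
    exact hout y hy ⟨h.2, h.1⟩
  obtain ⟨y, -, hy1, hy2⟩ := hs _ _ isOpen_interior isClosed_closure.isOpen_compl hsub
    ⟨x, hx, (hsub hx).resolve_right fun h => h (subset_closure hxΓ)⟩
    ⟨w, hw, (hsub hw).resolve_left fun h => hwΓ (interior_subset h)⟩
  exact hy2 (subset_closure (interior_subset hy1))

/-- Two vectors at a small distance, one in `n Γ` and the other one outside. -/
lemma IsFailureSet.exists_mismatch_le (hΓ : IsFailureSet A ν Γ) (hZ : IsNoise P Z ν α) {η : ℝ}
    (hη : 0 < η) :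
    ∃ ε : ℝ, 0 < ε ∧ ∀ᶠ n : ℕ in atTop, ∀ (i : ℤ) (W : Ω → Vec d),
      P.real {ω | ‖W ω - op (coefSum A) (Z i ω)‖ ≤ ε * (n + ‖Z i ω‖) ∧
        ¬ (op (coefSum A) (Z i ω) ∈ (n : ℝ) • Γ ↔ W ω ∈ (n : ℝ) • Γ)} ≤
        η * tail P (Z 0) n := by
  obtain ⟨δ₀, c, hδ, hc, hsub, -, -⟩ := hΓ.exists_jump_const
  obtain ⟨R, hR, hRev⟩ := hZ.heavyTail.tail_small (η / 2) (by positivity)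
  obtain ⟨ε, hε, hεev⟩ := hZ.regVar.eventually_frontier_le (hZ.measurable 0) (op (coefSum A)) hδ
    hsub hΓ.frontier_null R (show 0 < η / 2 by positivity)
  -- When `‖Z i‖ ≤ R n`, the allowed distance `ε / (1 + R) * (n + ‖Z i‖)` is at most `ε n`; the case
  -- `‖Z i‖ > R n` is paid for by `tail_small`.
  refine ⟨ε / (1 + R), by positivity, ?_⟩
  filter_upwards [hRev, tendsto_natCast_atTop_atTop.eventually hεev, eventually_gt_atTop 0]
    with n h1 h2 hn i W
  have hn' : (0 : ℝ) < n := by exact_mod_cast hn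
  set T := op (coefSum A)
  have hm1 : MeasurableSet {y : Vec d | R * n < ‖y‖} :=
    measurableSet_lt measurable_const measurable_norm
  have hm2 : MeasurableSet {y : Vec d | ‖(n : ℝ)⁻¹ • y‖ ≤ R ∧
      T ((n : ℝ)⁻¹ • y) ∈ Metric.cthickening ε (frontier Γ)} := by
    have h1 : IsClosed {y : Vec d | ‖(n : ℝ)⁻¹ • y‖ ≤ R} :=
      isClosed_le (by fun_prop) continuous_const
    have h2 : IsClosed {y : Vec d | T ((n : ℝ)⁻¹ • y) ∈ Metric.cthickening ε (frontier Γ)} :=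
      Metric.isClosed_cthickening.preimage (by fun_prop)
    exact (h1.inter h2).measurableSet
  calc _ ≤ P.real ({ω | Z i ω ∈ {y : Vec d | R * n < ‖y‖}} ∪
        {ω | Z i ω ∈ {y : Vec d | ‖(n : ℝ)⁻¹ • y‖ ≤ R ∧
          T ((n : ℝ)⁻¹ • y) ∈ Metric.cthickening ε (frontier Γ)}}) := by
        refine measureReal_mono (fun ω hω => ?_) (measure_ne_top _ _)
        obtain ⟨hd, hmis⟩ := hω
        by_cases hz : R * n < ‖Z i ω‖
        · exact Or.inl hz
        · right
          have hz' : ‖(n : ℝ)⁻¹ • Z i ω‖ ≤ R := by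
            rw [norm_smul, norm_inv, Real.norm_of_nonneg hn'.le, inv_mul_le_iff₀ hn']
            linarith
          refine ⟨hz', ?_⟩
          set x : Vec d := (n : ℝ)⁻¹ • T (Z i ω) with hx
          set w : Vec d := (n : ℝ)⁻¹ • W ω with hw
          have hxT : T ((n : ℝ)⁻¹ • Z i ω) = x := map_smul _ _ _
          have hdist : dist w x ≤ ε := by
            rw [dist_eq_norm, hx, hw, ← smul_sub, norm_smul, norm_inv,
              Real.norm_of_nonneg hn'.le, inv_mul_le_iff₀ hn']
            refine hd.trans ?_
            rw [div_mul_eq_mul_div, div_le_iff₀ (by positivity)]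
            have : ε * (n + ‖Z i ω‖) ≤ ε * (n + R * n) := by gcongr; exact not_lt.1 hz
            linarith
          rw [mem_natCast_smul_iff hn, mem_natCast_smul_iff hn, ← hx, ← hw] at hmis
          have hpre : IsPreconnected (segment ℝ x w) := (convex_segment x w).isPreconnected
          have hne : (segment ℝ x w ∩ frontier Γ).Nonempty := by
            by_cases hxΓ : x ∈ Γ
            · have hwΓ : w ∉ Γ := fun h => hmis ⟨fun _ => h, fun _ => hxΓ⟩
              exact inter_frontier_nonempty hpre ⟨x, left_mem_segment ℝ x w, hxΓ⟩
                ⟨w, right_mem_segment ℝ x w, hwΓ⟩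
            · have hwΓ : w ∈ Γ := by
                by_contra h; exact hmis ⟨fun h' => absurd h' hxΓ, fun h' => absurd h' h⟩
              exact inter_frontier_nonempty hpre ⟨w, right_mem_segment ℝ x w, hwΓ⟩
                ⟨x, left_mem_segment ℝ x w, hxΓ⟩
          obtain ⟨z, hzseg, hzfr⟩ := hne
          have hzb : z ∈ Metric.closedBall x ε :=
            (convex_closedBall x ε).segment_subset (Metric.mem_closedBall_self hε.le)
              (Metric.mem_closedBall.2 hdist) hzseg
          rw [hxT]
          exact Metric.mem_cthickening_of_dist_le x z ε _ hzfr
            (by rw [dist_comm]; exact Metric.mem_closedBall.1 hzb)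
    _ ≤ _ := measureReal_union_le _ _
    _ ≤ η / 2 * tail P (Z 0) n + η / 2 * tail P (Z 0) n := by
        refine add_le_add ?_ ?_
        · rw [hZ.prob_eq i hm1]; exact h1
        · rw [hZ.prob_eq i hm2]; exact h2
    _ = η * tail P (Z 0) n := by ring

/-- Jumps without failure. -/
lemma IsFailureSet.jump_not_failure_le (hΓ : IsFailureSet A ν Γ) (hA : IsCoef A)
    (hZ : IsNoise P Z ν α) {η : ℝ} (hη : 0 < η) :
    ∃ K : ℝ, 0 < K ∧ ∀ᶠ n : ℕ in atTop, ∀ I : Finset ℕ, I ⊆ Finset.range n →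
      P.real {ω | (∃ i ∈ I, op (coefSum A) (Z (i : ℤ) ω) ∈ (n : ℝ) • Γ) ∧
        S A Z 0 n ω ∉ (n : ℝ) • Γ} ≤ (η * I.card + K) * tail P (Z 0) n := by
  obtain ⟨δ₀, c, hδ, hc, hsub, -, hjump⟩ := hΓ.exists_jump_const
  obtain ⟨D, hD, hDev⟩ := hZ.heavyTail.tail_mul_le c hc
  obtain ⟨ε, hε, hmis⟩ := hΓ.exists_mismatch_le hZ (show 0 < η / 2 by positivity)
  obtain ⟨K, hK⟩ := hA.exists_window hε
  have hrest := hZ.jump_and_rest (weightConst_pos (A := A)) hε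
    (show 0 < η / (2 * D) by positivity)
  refine ⟨2 * K * D + 1, by positivity, ?_⟩
  filter_upwards [hDev, hmis, hrest, eventually_gt_atTop 0] with n h1 h2 h3 hn I hI
  have hq := tail_nonneg (P := P) (Y := Z 0) n
  set T := op (coefSum A)
  set E : ℕ → Set Ω := fun i => {ω | T (Z (i : ℤ) ω) ∈ (n : ℝ) • Γ ∧ S A Z 0 n ω ∉ (n : ℝ) • Γ}
  -- Inside the window the weight is within `ε` of `𝒜`, so either the rest of the sum is large or
  -- there is a mismatch near the boundary of `n Γ`. At most `2 * K` other indices get the crude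
  -- bound `D * tail P (Z 0) n`; they produce the additive constant.
  have hin : ∀ i : ℕ, (K : ℤ) ≤ i ∧ (i : ℤ) < n - K → P.real (E i) ≤ η * tail P (Z 0) n := by
    rintro i ⟨hi1, hi2⟩
    calc P.real (E i) ≤ P.real ({ω | c * n < ‖Z i ω‖ ∧
            ε * n < ‖S A Z 0 n ω - weight A n i (Z i ω)‖} ∪
          {ω | ‖S A Z 0 n ω - T (Z i ω)‖ ≤ ε * (n + ‖Z i ω‖) ∧
            ¬ (T (Z i ω) ∈ (n : ℝ) • Γ ↔ S A Z 0 n ω ∈ (n : ℝ) • Γ)}) := by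
          refine measureReal_mono (fun ω hω => ?_) (measure_ne_top _ _)
          by_cases hr : ε * n < ‖S A Z 0 n ω - weight A n i (Z i ω)‖
          · exact Or.inl ⟨hjump n hn _ hω.1, hr⟩
          · refine Or.inr ⟨?_, fun h => hω.2 (h.1 hω.1)⟩
            have hw := ((weight A n i - T).le_opNorm (Z i ω)).trans
              (mul_le_mul_of_nonneg_right ((hK n).1 i hi1 hi2) (norm_nonneg _))
            rw [sub_apply] at hw
            have htri := norm_add_le (S A Z 0 n ω - weight A n i (Z i ω))
              (weight A n i (Z i ω) - T (Z i ω))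
            rw [sub_add_sub_cancel] at htri
            linarith [not_lt.1 hr]
      _ ≤ _ := measureReal_union_le _ _
      _ ≤ D * tail P (Z 0) n * (η / (2 * D)) + η / 2 * tail P (Z 0) n := by
          refine add_le_add ((h3 _ (hA.weightBound n) _ (hA.hasSum_S hZ n) i _).trans ?_) (h2 i _)
          gcongr
      _ = η * tail P (Z 0) n := by field_simp; ring
  have hall : ∀ i : ℕ, P.real (E i) ≤ D * tail P (Z 0) n := by
    intro i
    refine le_trans ?_ h1
    have hprob : P.real {ω | c * n < ‖Z i ω‖} = tail P (Z 0) (c * n) :=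
      hZ.prob_eq i (s := {y : Vec d | c * n < ‖y‖})
        (measurableSet_lt measurable_const measurable_norm)
    rw [← hprob]
    exact measureReal_mono fun ω hω => hjump n hn _ hω.1
  set I' := I.filter fun i : ℕ => ¬ ((K : ℤ) ≤ i ∧ (i : ℤ) < n - K)
  have hcard : I'.card ≤ 2 * K := by
    have hsub' : I' ⊆ Finset.range K ∪ Finset.Ico (n - K) n := by
      intro i hi
      have h4 := Finset.mem_range.1 (hI (Finset.mem_filter.1 hi).1)
      have h5 := (Finset.mem_filter.1 hi).2
      rw [Finset.mem_union, Finset.mem_range, Finset.mem_Ico]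
      omega
    refine (Finset.card_le_card hsub').trans ((Finset.card_union_le _ _).trans ?_)
    rw [Finset.card_range, Nat.card_Ico]
    omega
  calc _ ≤ P.real (⋃ i ∈ I, E i) := by
        refine measureReal_mono (fun ω hω => ?_) (measure_ne_top _ _)
        obtain ⟨⟨i, hi, hiΓ⟩, hS⟩ := hω
        exact Set.mem_biUnion hi ⟨hiΓ, hS⟩
    _ ≤ ∑ i ∈ I, P.real (E i) := measureReal_biUnion_finset_le _ _
    _ ≤ ∑ i ∈ I, (η * tail P (Z 0) n +
          if ¬ ((K : ℤ) ≤ i ∧ (i : ℤ) < n - K) then D * tail P (Z 0) n else (0 : ℝ)) := by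
        refine Finset.sum_le_sum fun i _ => ?_
        by_cases h : (K : ℤ) ≤ i ∧ (i : ℤ) < n - K
        · rw [if_neg (not_not.2 h), add_zero]; exact hin i h
        · rw [if_pos h]
          exact (hall i).trans (le_add_of_nonneg_left (mul_nonneg hη.le hq))
    _ = η * tail P (Z 0) n * I.card + I'.card * (D * tail P (Z 0) n) := by
        rw [Finset.sum_add_distrib, ← Finset.sum_filter, Finset.sum_const, Finset.sum_const,
          nsmul_eq_mul, nsmul_eq_mul, mul_comm (I.card : ℝ)]
    _ ≤ η * tail P (Z 0) n * I.card + (2 * K : ℕ) * (D * tail P (Z 0) n) := by gcongr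
    _ ≤ (η * I.card + (2 * K * D + 1)) * tail P (Z 0) n := by
        push_cast
        nlinarith

lemma measureReal_exists_le {E : ℤ → Set Ω} {p : ℤ → Prop} {c : ℝ}
    (h : ∀ F : Finset ℤ, (∀ j ∈ F, p j) → ∑ j ∈ F, P.real (E j) ≤ c) :
    P.real {ω | ∃ j, p j ∧ ω ∈ E j} ≤ c := by
  have h0 : 0 ≤ c := by simpa using h ∅ (by simp)
  refine ENNReal.toReal_le_of_le_ofReal h0 ?_
  calc P {ω | ∃ j, p j ∧ ω ∈ E j} ≤ P (⋃ j : {j // p j}, E j) := by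
        refine measure_mono ?_
        rintro ω ⟨j, hj, hω⟩
        exact Set.mem_iUnion.2 ⟨⟨j, hj⟩, hω⟩
    _ ≤ ∑' j : {j // p j}, P (E j) := measure_iUnion_le _
    _ ≤ ENNReal.ofReal c := by
        rw [ENNReal.tsum_eq_iSup_sum]
        refine iSup_le fun F => ?_
        have h1 := h (F.map (Function.Embedding.subtype p)) (by
          intro j hj
          obtain ⟨j', -, rfl⟩ := Finset.mem_map.1 hj
          exact j'.2)
        rw [Finset.sum_map] at h1
        refine le_trans (le_of_eq ?_) (ENNReal.ofReal_le_ofReal h1)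
        rw [ENNReal.ofReal_sum_of_nonneg fun _ _ => measureReal_nonneg]
        exact Finset.sum_congr rfl fun j _ => (ofReal_measureReal (measure_ne_top _ _)).symm

/-- Failure without jumps. -/
lemma IsFailureSet.failure_not_jump_le (hΓ : IsFailureSet A ν Γ) (hA : IsCoef A)
    (hZ : IsNoise P Z ν α) {η : ℝ} (hη : 0 < η) :
    ∀ᶠ n : ℕ in atTop,
      P.real {ω | S A Z 0 n ω ∈ (n : ℝ) • Γ ∧
        ∀ i ∈ Finset.range n, op (coefSum A) (Z (i : ℤ) ω) ∉ (n : ℝ) • Γ} ≤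
        η * (n * tail P (Z 0) n) := by
  have hC := weightConst_pos (A := A)
  set C := weightConst A
  obtain ⟨δ₀, c, hδ₀, hc, hsub, hfail, hjump⟩ := hΓ.exists_jump_const
  obtain ⟨δ, hδ, htr⟩ := hZ.exists_truncation hC hδ₀
  obtain ⟨D, hD, hlarge⟩ := hZ.exists_large_le hC hδ
  obtain ⟨D', hD', hDev⟩ := hZ.heavyTail.tail_mul_le (δ / C) (by positivity)
  obtain ⟨ε, hε, hmis⟩ := hΓ.exists_mismatch_le hZ (show 0 < η / 4 by positivity)
  obtain ⟨K, hK⟩ := hA.exists_window (show 0 < min ε (η / (4 * D)) by positivity)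
  have hrest := hZ.jump_and_rest hC hε (show 0 < η / (4 * D') by positivity)
  filter_upwards [htr, hlarge, hDev, hmis, hrest, eventually_gt_atTop 0,
    tendsto_natCast_atTop_atTop.eventually_ge_atTop ((1 + 4 * K * C * D) / (η / 4))]
    with n h1 h2 h3 h4 h5 hn hnK
  have hq := tail_nonneg (P := P) (Y := Z 0) n
  have hn' : (0 : ℝ) < n := by exact_mod_cast hn
  set q := tail P (Z 0) n with hqdef
  set T := op (coefSum A)
  set far : ℤ → Prop := fun j => ¬ ((K : ℤ) ≤ j ∧ j < n - K)
  -- Failure without a jump has four causes: no large summand (`E₁`), a large one outside the window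
  -- (`E₂`), a large one inside with a large rest (`E₃`), or one inside with a small rest, so that
  -- `S_0^n` and `𝒜 Z_j` are close but only one is in `n Γ` (`E₄`).
  set E₁ : Set Ω := {ω | ω ∈ {ω | ∀ j, ‖weight A n j (Z j ω)‖ ≤ δ * n} ∧
    δ₀ * n < ‖S A Z 0 n ω‖} with hE₁
  set E₂ : Set Ω := {ω | ∃ j, far j ∧ ω ∈ {ω | δ * n < ‖weight A n j (Z j ω)‖}}
  set E₃ : ℤ → Set Ω := fun j => {ω | δ / C * n < ‖Z j ω‖ ∧
    ε * n < ‖S A Z 0 n ω - weight A n j (Z j ω)‖}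
  set E₄ : ℤ → Set Ω := fun j => {ω | ‖S A Z 0 n ω - T (Z j ω)‖ ≤ ε * (n + ‖Z j ω‖) ∧
    ¬ (T (Z j ω) ∈ (n : ℝ) • Γ ↔ S A Z 0 n ω ∈ (n : ℝ) • Γ)}
  have b1 : P.real E₁ ≤ q := by
    refine measureReal_le_of_hasSum (hA.hasSum_S hZ n) fun F => ?_
    refine (measureReal_mono (fun ω hω => ?_) (measure_ne_top _ _)).trans
      (h1 _ (hA.weightBound n) F)
    exact ⟨hω.2, fun j _ => hω.1 j⟩
  have b2 : P.real E₂ ≤ (η / 4 * n + 4 * K * C * D) * q := by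
    refine measureReal_exists_le fun F hF => ?_
    calc ∑ j ∈ F, P.real {ω | δ * n < ‖weight A n j (Z j ω)‖}
        ≤ ∑ j ∈ F, D * ‖weight A n j‖ * q :=
          Finset.sum_le_sum fun j _ => h2 _ ((hA.weightBound n).1 j) j
      _ = D * (∑ j ∈ F, ‖weight A n j‖) * q := by rw [← Finset.sum_mul, ← Finset.mul_sum]
      _ ≤ D * (η / (4 * D) * n + 4 * K * C) * q := by
          gcongr
          refine ((hK n).2 F hF).trans ?_
          gcongr
          exact min_le_right _ _
      _ = (η / 4 * n + 4 * K * C * D) * q := by field_simp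
  have b3 : ∀ j, P.real (E₃ j) ≤ η / 4 * q := fun j => by
    refine (h5 _ (hA.weightBound n) _ (hA.hasSum_S hZ n) j _).trans ?_
    calc tail P (Z 0) (δ / C * n) * (η / (4 * D')) ≤ D' * q * (η / (4 * D')) := by gcongr
      _ = η / 4 * q := by field_simp
  have b4 : ∀ j, P.real (E₄ j) ≤ η / 4 * q := fun j => h4 j _
  have hcover : {ω | S A Z 0 n ω ∈ (n : ℝ) • Γ ∧
      ∀ i ∈ Finset.range n, T (Z (i : ℤ) ω) ∉ (n : ℝ) • Γ} ⊆
      (E₁ ∪ E₂) ∪ ⋃ i ∈ Finset.range n, (E₃ (i : ℤ) ∪ E₄ (i : ℤ)) := by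
    rintro ω ⟨hS, hJ⟩
    by_cases hall : ∀ j, ‖weight A n j (Z j ω)‖ ≤ δ * n
    · exact Or.inl (Or.inl ⟨hall, hfail n hn _ hS⟩)
    · push Not at hall
      obtain ⟨j, hj⟩ := hall
      by_cases hf : far j
      · exact Or.inl (Or.inr ⟨j, hf, hj⟩)
      · right
        obtain ⟨hj1, hj2⟩ := not_not.1 hf
        obtain ⟨i, rfl⟩ := Int.eq_ofNat_of_zero_le (show 0 ≤ j by omega)
        have hi : i ∈ Finset.range n := Finset.mem_range.2 (by omega)
        refine Set.mem_biUnion hi ?_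
        by_cases hr : ε * n < ‖S A Z 0 n ω - weight A n i (Z i ω)‖
        · left
          refine ⟨?_, hr⟩
          have h6 := hj.trans_le (((weight A n i).le_opNorm (Z i ω)).trans
            (mul_le_mul_of_nonneg_right ((hA.weightBound n).1 i) (norm_nonneg _)))
          rw [div_mul_eq_mul_div, div_lt_iff₀ hC]
          linarith
        · right
          refine ⟨?_, fun h => hJ i hi (h.2 hS)⟩
          have hw := ((weight A n i - T).le_opNorm (Z i ω)).trans
            (mul_le_mul_of_nonneg_right (((hK n).1 i hj1 hj2).trans (min_le_left _ _))
              (norm_nonneg _))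
          rw [sub_apply] at hw
          have htri := norm_add_le (S A Z 0 n ω - weight A n i (Z i ω))
            (weight A n i (Z i ω) - T (Z i ω))
          rw [sub_add_sub_cancel] at htri
          linarith [not_lt.1 hr]
  calc _ ≤ _ := measureReal_mono hcover (measure_ne_top _ _)
    _ ≤ _ := measureReal_union_le _ _
    _ ≤ (P.real E₁ + P.real E₂) +
        ∑ i ∈ Finset.range n, (P.real (E₃ (i : ℤ)) + P.real (E₄ (i : ℤ))) :=
        add_le_add (measureReal_union_le _ _) ((measureReal_biUnion_finset_le _ _).trans
          (Finset.sum_le_sum fun _ _ => measureReal_union_le _ _))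
    _ ≤ (q + (η / 4 * n + 4 * K * C * D) * q) +
        ∑ _i ∈ Finset.range n, (η / 4 * q + η / 4 * q) :=
        add_le_add (add_le_add b1 b2) (Finset.sum_le_sum fun i _ => add_le_add (b3 i) (b4 i))
    _ = (1 + 4 * K * C * D) * q + 3 * (η / 4 * n) * q := by
        rw [Finset.sum_const, Finset.card_range, nsmul_eq_mul]; ring
    _ ≤ η / 4 * n * q + 3 * (η / 4 * n) * q := by
        gcongr
        rw [div_le_iff₀ (by positivity)] at hnK
        linarith
    _ = η * (n * q) := by ring

end FailureEvents

/-! ### Comparison of the five quantities -/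

section Comparison

variable {Ω : Type*} [MeasurableSpace Ω] {d : ℕ} {P : Measure Ω} [IsProbabilityMeasure P]
  {A : ℤ → Matrix (Fin d) (Fin d) ℝ} {Z : ℤ → Ω → Vec d} {ν : Measure (Punctured d)} {α : ℝ}
  {Γ : Set (Vec d)}

/-- The probability `P(𝒜 Z_0 ∈ n Γ)`. -/
noncomputable def jumpProb (P : Measure Ω) (A : ℤ → Matrix (Fin d) (Fin d) ℝ)
    (Z : ℤ → Ω → Vec d) (Γ : Set (Vec d)) (n : ℕ) : ℝ :=
  P.real {ω | op (coefSum A) (Z 0 ω) ∈ (n : ℝ) • Γ}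

omit [IsProbabilityMeasure P] in
lemma jumpProb_nonneg (n : ℕ) : 0 ≤ jumpProb P A Z Γ n := measureReal_nonneg

lemma IsFailureSet.le_jumpProb (hΓ : IsFailureSet A ν Γ) (hZ : IsNoise P Z ν α) :
    ∃ m : ℝ, 0 < m ∧ ∀ᶠ n : ℕ in atTop, m * tail P (Z 0) n ≤ jumpProb P A Z Γ n := by
  obtain ⟨δ₀, c, hδ₀, hc, hsub, hfail, hjump⟩ := hΓ.exists_jump_const
  have h0 : (0 : Vec d) ∉ Γ := fun h => by
    have := hsub h
    simp [hδ₀.le] at this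
  obtain ⟨m, hm, hev⟩ := hZ.regVar.eventually_le_failure (hZ.measurable 0) (op (coefSum A)) h0
    hΓ.pos hΓ.frontier_null
  refine ⟨m, hm, ?_⟩
  filter_upwards [tendsto_natCast_atTop_atTop.eventually hev, eventually_gt_atTop 0] with n hn hn0
  refine hn.trans (measureReal_mono fun ω hω => ?_)
  rw [Set.mem_ofPred_eq, mem_natCast_smul_iff hn0, ← map_smul]
  exact hω

lemma IsFailureSet.tendsto_mul_jumpProb (hΓ : IsFailureSet A ν Γ) (hZ : IsNoise P Z ν α) :
    Tendsto (fun n : ℕ => n * jumpProb P A Z Γ n) atTop (𝓝 0) := by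
  obtain ⟨δ₀, c, hδ₀, hc, hsub, hfail, hjump⟩ := hΓ.exists_jump_const
  obtain ⟨D, hD, hDev⟩ := hZ.heavyTail.tail_mul_le c hc
  have hlim : Tendsto (fun n : ℕ => D * (n * tail P (Z 0) n)) atTop (𝓝 0) := by
    simpa using hZ.heavyTail.mul_tail.const_mul D
  refine squeeze_zero' (Eventually.of_forall fun n => mul_nonneg n.cast_nonneg
    (jumpProb_nonneg n)) ?_ hlim
  filter_upwards [hDev, eventually_gt_atTop 0] with n hn hn0
  have h1 : jumpProb P A Z Γ n ≤ D * tail P (Z 0) n := by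
    refine le_trans ?_ hn
    exact measureReal_mono fun ω hω => hjump n hn0 _ hω
  calc n * jumpProb P A Z Γ n ≤ n * (D * tail P (Z 0) n) := by gcongr
    _ = D * (n * tail P (Z 0) n) := by ring

/-- The event that some `𝒜 Z_i`, `i ∈ I`, lies in `n Γ`. -/
def jumpEvent (A : ℤ → Matrix (Fin d) (Fin d) ℝ) (Z : ℤ → Ω → Vec d) (Γ : Set (Vec d)) (n : ℕ)
    (I : Finset ℕ) : Set Ω := {ω | ∃ i ∈ I, op (coefSum A) (Z (i : ℤ) ω) ∈ (n : ℝ) • Γ}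

omit [IsProbabilityMeasure P] in
lemma IsNoise.prob_jump (hZ : IsNoise P Z ν α) (hΓ : MeasurableSet Γ) {n : ℕ} (hn : 0 < n)
    (i : ℤ) : P.real {ω | op (coefSum A) (Z i ω) ∈ (n : ℝ) • Γ} = jumpProb P A Z Γ n :=
  hZ.prob_eq i (measurableSet_jump (op (coefSum A)) hΓ hn)

lemma IsNoise.prob_jumpEvent_le (hZ : IsNoise P Z ν α) (hΓ : MeasurableSet Γ) {n : ℕ}
    (hn : 0 < n) (I : Finset ℕ) :
    P.real (jumpEvent A Z Γ n I) ≤ I.card * jumpProb P A Z Γ n := by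
  calc P.real (jumpEvent A Z Γ n I)
      ≤ P.real (⋃ i ∈ I, {ω | op (coefSum A) (Z (i : ℤ) ω) ∈ (n : ℝ) • Γ}) := by
        refine measureReal_mono (fun ω hω => ?_) (measure_ne_top _ _)
        obtain ⟨i, hi, h⟩ := hω
        exact Set.mem_biUnion hi h
    _ ≤ ∑ i ∈ I, P.real {ω | op (coefSum A) (Z (i : ℤ) ω) ∈ (n : ℝ) • Γ} :=
        measureReal_biUnion_finset_le _ _
    _ = I.card * jumpProb P A Z Γ n := by
        rw [← nsmul_eq_mul, ← Finset.sum_const]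
        exact Finset.sum_congr rfl fun i _ => hZ.prob_jump hΓ hn i

/-- A Bonferroni bound by induction: by pairwise independence, a new index overlaps the earlier
jumps with probability at most `I.card * p ^ 2`. -/
lemma IsNoise.le_prob_jumpEvent (hZ : IsNoise P Z ν α) (hΓ : MeasurableSet Γ) {n : ℕ}
    (hn : 0 < n) (I : Finset ℕ) :
    I.card * jumpProb P A Z Γ n - (I.card * jumpProb P A Z Γ n) ^ 2 ≤
      P.real (jumpEvent A Z Γ n I) := by
  have hp := jumpProb_nonneg (P := P) (A := A) (Z := Z) (Γ := Γ) n
  set p := jumpProb P A Z Γ n with hpdef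
  have hmeas := measurableSet_jump (op (coefSum A)) hΓ hn
  have hJm : ∀ i : ℕ, MeasurableSet {ω | op (coefSum A) (Z (i : ℤ) ω) ∈ (n : ℝ) • Γ} := fun i =>
    hZ.measurable i hmeas
  induction I using Finset.induction_on with
  | empty => simp [jumpEvent]
  | insert a I ha ih =>
    set Ja : Set Ω := {ω | op (coefSum A) (Z (a : ℤ) ω) ∈ (n : ℝ) • Γ}
    have hJa : P.real Ja = p := hZ.prob_jump hΓ hn a
    have hins : jumpEvent A Z Γ n (insert a I) = jumpEvent A Z Γ n I ∪ Ja := by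
      ext ω
      simp only [jumpEvent, Set.mem_ofPred_eq, Finset.exists_mem_insert, Set.mem_union, Ja]
      exact or_comm
    have hinter : P.real (jumpEvent A Z Γ n I ∩ Ja) ≤ I.card * p ^ 2 := by
      calc P.real (jumpEvent A Z Γ n I ∩ Ja)
          ≤ P.real (⋃ i ∈ I, {ω | Z (i : ℤ) ω ∈ {y | op (coefSum A) y ∈ (n : ℝ) • Γ} ∧
              Z (a : ℤ) ω ∈ {y | op (coefSum A) y ∈ (n : ℝ) • Γ}}) := by
            refine measureReal_mono (fun ω hω => ?_) (measure_ne_top _ _)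
            obtain ⟨⟨i, hi, h⟩, h'⟩ := hω
            exact Set.mem_biUnion hi ⟨h, h'⟩
        _ ≤ _ := measureReal_biUnion_finset_le _ _
        _ = ∑ _i ∈ I, p ^ 2 := by
            refine Finset.sum_congr rfl fun i hi => ?_
            have hia : (i : ℤ) ≠ a := fun h => ha (by rwa [← Int.natCast_inj.1 h])
            rw [hZ.prob_pair hia hmeas hmeas, sq]
            rfl
        _ = I.card * p ^ 2 := by rw [Finset.sum_const, nsmul_eq_mul]
    have hunion := measureReal_union_add_inter (μ := P) (s := jumpEvent A Z Γ n I) (hJm a)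
    rw [hins, Finset.card_insert_of_notMem ha]
    push_cast
    have hunion' : P.real (jumpEvent A Z Γ n I ∪ Ja) + P.real (jumpEvent A Z Γ n I ∩ Ja) =
      P.real (jumpEvent A Z Γ n I) + P.real Ja := hunion
    have hcard : (0 : ℝ) ≤ I.card := Nat.cast_nonneg _
    nlinarith [mul_nonneg hcard (sq_nonneg p), sq_nonneg p]

variable {I : ℕ → Finset ℕ}

lemma isEquivalent_of_abs_sub_le {a b : ℕ → ℝ} (hb : ∀ n, 0 ≤ b n)
    (h : ∀ η : ℝ, 0 < η → ∀ᶠ n in atTop, |a n - b n| ≤ η * b n) :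
    Asymptotics.IsEquivalent atTop a b := by
  refine Asymptotics.isLittleO_iff.2 fun η hη => (h η hη).mono fun n hn => ?_
  rwa [Real.norm_eq_abs, Real.norm_of_nonneg (hb n)]

omit [IsProbabilityMeasure P] in
lemma card_mul_jumpProb_nonneg (n : ℕ) : 0 ≤ ((I n).card : ℝ) * jumpProb P A Z Γ n :=
  mul_nonneg (Nat.cast_nonneg _) (jumpProb_nonneg n)

lemma card_le_of_subset_range (hI : ∀ n, I n ⊆ Finset.range n) (n : ℕ) :
    ((I n).card : ℝ) ≤ n := by
  have := Finset.card_le_card (hI n)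
  rw [Finset.card_range] at this
  exact_mod_cast this

/-- A jump in `I_n` asymptotically comes from exactly one index. -/
lemma IsFailureSet.jumpEvent_close (hΓ : IsFailureSet A ν Γ) (hZ : IsNoise P Z ν α)
    (hI : ∀ n, I n ⊆ Finset.range n) {η : ℝ} (hη : 0 < η) :
    ∀ᶠ n : ℕ in atTop, |P.real (jumpEvent A Z Γ n (I n)) - (I n).card * jumpProb P A Z Γ n| ≤
      η * ((I n).card * jumpProb P A Z Γ n) := by
  filter_upwards [(hΓ.tendsto_mul_jumpProb hZ).eventually_lt_const hη, eventually_gt_atTop 0]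
    with n h1 hn
  have h2 := hZ.prob_jumpEvent_le (A := A) hΓ.measurableSet hn (I n)
  have h3 := hZ.le_prob_jumpEvent (A := A) hΓ.measurableSet hn (I n)
  have hb := card_mul_jumpProb_nonneg (P := P) (A := A) (Z := Z) (Γ := Γ) (I := I) n
  have h4 : (I n).card * jumpProb P A Z Γ n ≤ η :=
    (mul_le_mul_of_nonneg_right (card_le_of_subset_range hI n) (jumpProb_nonneg n)).trans h1.le
  rw [abs_le]
  constructor <;> nlinarith

/-- Failures together with jumps in `I_n`. -/
lemma IsFailureSet.failure_jump_close (hΓ : IsFailureSet A ν Γ) (hA : IsCoef A)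
    (hZ : IsNoise P Z ν α) (hI : ∀ n, I n ⊆ Finset.range n)
    (hcard : Tendsto (fun n => (I n).card) atTop atTop) {η : ℝ} (hη : 0 < η) :
    ∀ᶠ n : ℕ in atTop, |P.real {ω | S A Z 0 n ω ∈ (n : ℝ) • Γ ∧
        ∃ i ∈ I n, op (coefSum A) (Z (i : ℤ) ω) ∈ (n : ℝ) • Γ} -
        (I n).card * jumpProb P A Z Γ n| ≤ η * ((I n).card * jumpProb P A Z Γ n) := by
  obtain ⟨m, hm, hmev⟩ := hΓ.le_jumpProb hZ
  obtain ⟨K, hK, hev⟩ := hΓ.jump_not_failure_le hA hZ (show 0 < η / 4 * m by positivity)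
  filter_upwards [hmev, hev, hΓ.jumpEvent_close hZ hI (half_pos hη),
    -- Here `|I_n| → ∞` is essential: it absorbs the contribution `K` of the boundary indices.
    (tendsto_natCast_atTop_atTop.comp hcard).eventually_ge_atTop (K / (η / 4 * m))]
    with n h1 h2 h3 h4
  set E := {ω | S A Z 0 n ω ∈ (n : ℝ) • Γ ∧
    ∃ i ∈ I n, op (coefSum A) (Z (i : ℤ) ω) ∈ (n : ℝ) • Γ}
  have hb := card_mul_jumpProb_nonneg (P := P) (A := A) (Z := Z) (Γ := Γ) (I := I) n
  have hq := tail_nonneg (P := P) (Y := Z 0) n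
  have hle : P.real E ≤ P.real (jumpEvent A Z Γ n (I n)) := measureReal_mono fun ω hω => hω.2
  have hge : P.real (jumpEvent A Z Γ n (I n)) ≤ P.real E +
      (η / 4 * m * (I n).card + K) * tail P (Z 0) n := by
    refine le_trans ?_ (add_le_add_right (h2 (I n) (hI n)) _)
    refine (measureReal_mono (fun ω hω => ?_) (measure_ne_top _ _)).trans
      (measureReal_union_le _ _)
    by_cases hS : S A Z 0 n ω ∈ (n : ℝ) • Γ
    · exact Or.inl ⟨hS, hω⟩
    · exact Or.inr ⟨hω, hS⟩
  have hKle : K ≤ (I n).card * (η / 4 * m) := by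
    rwa [Function.comp_apply, div_le_iff₀ (by positivity)] at h4
  have herr : (η / 4 * m * (I n).card + K) * tail P (Z 0) n ≤
      η / 2 * ((I n).card * jumpProb P A Z Γ n) := by
    calc (η / 4 * m * (I n).card + K) * tail P (Z 0) n
        ≤ (η / 4 * m * (I n).card + (I n).card * (η / 4 * m)) * tail P (Z 0) n := by gcongr
      _ = η / 2 * ((I n).card * (m * tail P (Z 0) n)) := by ring
      _ ≤ _ := by gcongr
  rw [abs_le] at h3 ⊢
  constructor <;> linarith

/-- A union bound over pairs `(i, l)` with independence; there are at most `2 n M + 1` choices of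
`l`. The last factor tends to zero because `n q(n) → 0`. -/
lemma IsNoise.two_large_le (hZ : IsNoise P Z ν α) (hΓ : MeasurableSet Γ) {n : ℕ} (hn : 0 < n)
    (I : Finset ℕ) {M : ℝ} (hM : 0 ≤ M) (δ : ℝ) :
    P.real {ω | ∃ i ∈ I, op (coefSum A) (Z (i : ℤ) ω) ∈ (n : ℝ) • Γ ∧
      ∃ l : ℤ, l ≠ i ∧ -(n * M) ≤ (l : ℝ) ∧ (l : ℝ) ≤ n * M ∧ n * δ < ‖Z l ω‖} ≤
      I.card * jumpProb P A Z Γ n * ((2 * (n * M) + 1) * tail P (Z 0) (n * δ)) := by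
  have hnM : 0 ≤ n * M := by positivity
  have hmeas := measurableSet_jump (op (coefSum A)) hΓ hn
  have hball : MeasurableSet {y : Vec d | n * δ < ‖y‖} :=
    measurableSet_lt measurable_const measurable_norm
  set L : Finset ℤ := Finset.Icc (-⌊n * M⌋) ⌊n * M⌋
  have hL : (L.card : ℝ) ≤ 2 * (n * M) + 1 := by
    have h0 : 0 ≤ ⌊n * M⌋ := Int.floor_nonneg.2 hnM
    have h1 : ((L.card : ℤ) : ℝ) = 2 * (⌊n * M⌋ : ℝ) + 1 := by
      rw [Int.card_Icc, Int.toNat_of_nonneg (by omega)]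
      push_cast; ring
    have h2 := Int.floor_le (n * M)
    have h3 : ((L.card : ℤ) : ℝ) = (L.card : ℝ) := by push_cast; rfl
    linarith
  calc _ ≤ P.real (⋃ i ∈ I, ⋃ l ∈ L.filter (· ≠ (i : ℤ)),
          {ω | Z (i : ℤ) ω ∈ {y | op (coefSum A) y ∈ (n : ℝ) • Γ} ∧
            Z l ω ∈ {y : Vec d | n * δ < ‖y‖}}) := by
        refine measureReal_mono (fun ω hω => ?_) (measure_ne_top _ _)
        obtain ⟨i, hi, hiΓ, l, hl, hl1, hl2, hlarge⟩ := hω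
        refine Set.mem_biUnion hi (Set.mem_biUnion (x := l) ?_ ⟨hiΓ, hlarge⟩)
        refine Finset.mem_coe.2 (Finset.mem_filter.2 ⟨Finset.mem_Icc.2 ⟨?_, ?_⟩, hl⟩)
        · rw [neg_le]
          exact Int.le_floor.2 (by push_cast; linarith)
        · exact Int.le_floor.2 hl2
    _ ≤ ∑ i ∈ I, ∑ l ∈ L.filter (· ≠ (i : ℤ)),
          P.real {ω | Z (i : ℤ) ω ∈ {y | op (coefSum A) y ∈ (n : ℝ) • Γ} ∧
            Z l ω ∈ {y : Vec d | n * δ < ‖y‖}} :=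
        (measureReal_biUnion_finset_le _ _).trans
          (Finset.sum_le_sum fun i _ => measureReal_biUnion_finset_le _ _)
    _ ≤ ∑ i ∈ I, ∑ l ∈ L, jumpProb P A Z Γ n * tail P (Z 0) (n * δ) := by
        refine Finset.sum_le_sum fun i _ => ?_
        refine le_trans (Finset.sum_le_sum fun l hl => le_of_eq ?_)
          (Finset.sum_le_sum_of_subset_of_nonneg (Finset.filter_subset _ _)
            fun _ _ _ => mul_nonneg (jumpProb_nonneg n) (tail_nonneg _))
        exact hZ.prob_pair (Finset.mem_filter.1 hl).2.symm hmeas hball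
    _ = I.card * jumpProb P A Z Γ n * (L.card * tail P (Z 0) (n * δ)) := by
        rw [Finset.sum_const, Finset.sum_const, nsmul_eq_mul, nsmul_eq_mul]; ring
    _ ≤ _ := by
        have := jumpProb_nonneg (P := P) (A := A) (Z := Z) (Γ := Γ) n
        gcongr
        exact tail_nonneg _

/-- Failures together with exactly one jump. -/
lemma IsFailureSet.failure_single_jump_close (hΓ : IsFailureSet A ν Γ) (hA : IsCoef A)
    (hZ : IsNoise P Z ν α) (hI : ∀ n, I n ⊆ Finset.range n)
    (hcard : Tendsto (fun n => (I n).card) atTop atTop) {M δ : ℝ} (hM : 0 < M) (hδ : 0 < δ)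
    {η : ℝ} (hη : 0 < η) :
    ∀ᶠ n : ℕ in atTop, |P.real {ω | S A Z 0 n ω ∈ (n : ℝ) • Γ ∧
        ∃ i ∈ I n, op (coefSum A) (Z (i : ℤ) ω) ∈ (n : ℝ) • Γ ∧
        ∀ l : ℤ, l ≠ (i : ℤ) → -(n * M) ≤ (l : ℝ) → (l : ℝ) ≤ n * M → ‖Z l ω‖ ≤ n * δ} -
        (I n).card * jumpProb P A Z Γ n| ≤ η * ((I n).card * jumpProb P A Z Γ n) := by
  obtain ⟨D, hD, hDev⟩ := hZ.heavyTail.tail_mul_le δ hδ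
  have hlim : Tendsto (fun n : ℕ => (2 * M + 1) * D * (n * tail P (Z 0) n)) atTop (𝓝 0) := by
    simpa using hZ.heavyTail.mul_tail.const_mul ((2 * M + 1) * D)
  filter_upwards [hΓ.failure_jump_close hA hZ hI hcard (half_pos hη), hDev,
    hlim.eventually_lt_const (half_pos hη), eventually_gt_atTop 0] with n h1 h2 h3 hn
  have hn1 : (1 : ℝ) ≤ n := by exact_mod_cast hn
  have hq := tail_nonneg (P := P) (Y := Z 0) n
  have hb := card_mul_jumpProb_nonneg (P := P) (A := A) (Z := Z) (Γ := Γ) (I := I) n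
  set E := {ω | S A Z 0 n ω ∈ (n : ℝ) • Γ ∧
    ∃ i ∈ I n, op (coefSum A) (Z (i : ℤ) ω) ∈ (n : ℝ) • Γ}
  set E' := {ω | S A Z 0 n ω ∈ (n : ℝ) • Γ ∧
    ∃ i ∈ I n, op (coefSum A) (Z (i : ℤ) ω) ∈ (n : ℝ) • Γ ∧
      ∀ l : ℤ, l ≠ (i : ℤ) → -(n * M) ≤ (l : ℝ) → (l : ℝ) ≤ n * M → ‖Z l ω‖ ≤ n * δ}
  have hle : P.real E' ≤ P.real E := measureReal_mono fun ω hω =>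
    ⟨hω.1, hω.2.imp fun i hi => ⟨hi.1, hi.2.1⟩⟩
  have hge : P.real E ≤ P.real E' + (I n).card * jumpProb P A Z Γ n *
      ((2 * (n * M) + 1) * tail P (Z 0) (n * δ)) := by
    refine le_trans ?_ (add_le_add_right (hZ.two_large_le hΓ.measurableSet hn (I n) hM.le δ) _)
    refine (measureReal_mono (fun ω hω => ?_) (measure_ne_top _ _)).trans
      (measureReal_union_le _ _)
    obtain ⟨hS, i, hi, hiΓ⟩ := hω
    by_cases hl : ∀ l : ℤ, l ≠ (i : ℤ) → -(n * M) ≤ (l : ℝ) → (l : ℝ) ≤ n * M → ‖Z l ω‖ ≤ n * δ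
    · exact Or.inl ⟨hS, i, hi, hiΓ, hl⟩
    · push Not at hl
      exact Or.inr ⟨i, hi, hiΓ, hl⟩
  have herr : (2 * (n * M) + 1) * tail P (Z 0) (n * δ) ≤ η / 2 := by
    calc (2 * (n * M) + 1) * tail P (Z 0) (n * δ) ≤
          (2 * (n * M) + n) * (D * tail P (Z 0) n) := by
          rw [mul_comm (n : ℝ) δ]
          gcongr
          exact tail_nonneg _
      _ = (2 * M + 1) * D * (n * tail P (Z 0) n) := by ring
      _ ≤ η / 2 := h3.le
  have herr' := mul_le_mul_of_nonneg_left herr hb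
  rw [abs_le] at h1 ⊢
  constructor <;> linarith

/-- The lower bound is `failure_jump_close` with all indices `0, …, n - 1`; the upper bound adds the
failures without jumps to the jump probability. -/
lemma IsFailureSet.failure_close (hΓ : IsFailureSet A ν Γ) (hA : IsCoef A)
    (hZ : IsNoise P Z ν α) {η : ℝ} (hη : 0 < η) :
    ∀ᶠ n : ℕ in atTop, |P.real {ω | S A Z 0 n ω ∈ (n : ℝ) • Γ} - n * jumpProb P A Z Γ n| ≤
      η * (n * jumpProb P A Z Γ n) := by
  obtain ⟨m, hm, hmev⟩ := hΓ.le_jumpProb hZ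
  have hlow := hΓ.failure_jump_close hA hZ (I := Finset.range) (fun n => subset_rfl)
    (by simpa using! tendsto_id) hη
  filter_upwards [hmev, hlow, hΓ.failure_not_jump_le hA hZ (show 0 < η * m by positivity),
    eventually_gt_atTop 0] with n h1 h2 h3 hn
  have hup := hZ.prob_jumpEvent_le (A := A) hΓ.measurableSet hn (Finset.range n)
  rw [Finset.card_range] at h2 hup
  set E := {ω | S A Z 0 n ω ∈ (n : ℝ) • Γ}
  have hle : P.real E ≤ P.real (jumpEvent A Z Γ n (Finset.range n)) +
      η * m * (n * tail P (Z 0) n) := by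
    refine le_trans ?_ (add_le_add_right h3 _)
    refine (measureReal_mono (fun ω hω => ?_) (measure_ne_top _ _)).trans
      (measureReal_union_le _ _)
    by_cases hJ : ω ∈ jumpEvent A Z Γ n (Finset.range n)
    · exact Or.inl hJ
    · exact Or.inr ⟨hω, fun i hi h => hJ ⟨i, hi, h⟩⟩
  have hge : P.real {ω | S A Z 0 n ω ∈ (n : ℝ) • Γ ∧
      ∃ i ∈ Finset.range n, op (coefSum A) (Z (i : ℤ) ω) ∈ (n : ℝ) • Γ} ≤ P.real E :=
    measureReal_mono fun ω hω => hω.1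
  have herr : η * m * (n * tail P (Z 0) n) ≤ η * (n * jumpProb P A Z Γ n) := by
    calc η * m * (n * tail P (Z 0) n) = η * (n * (m * tail P (Z 0) n)) := by ring
      _ ≤ _ := by gcongr
  rw [abs_le] at h2 ⊢
  constructor <;> linarith

end Comparison

end MovingAverage

open MovingAverage
theorem proposition1 {d : ℕ} {Ω : Type*} [MeasurableSpace Ω] (P : Measure Ω)
    [IsProbabilityMeasure P] (A : ℤ → Matrix (Fin d) (Fin d) ℝ) (hA : IsCoef A)
    (Z : ℤ → Ω → Vec d) (ν : Measure (Punctured d)) (α : ℝ) (hZ : IsNoise P Z ν α)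
    (Γ : Set (Vec d)) (hΓ : IsFailureSet A ν Γ) :
    (∀ M δ : ℝ, 0 < M → 0 < δ → ∀ I : ℕ → Finset ℕ, (∀ n, I n ⊆ Finset.range n) →
      Tendsto (fun n => (I n).card) atTop atTop →
      ∀ a b : Fin 5, AsympEquiv (quantity P A Z Γ I M δ a) (quantity P A Z Γ I M δ b)) ∧
    Tendsto (fun n : ℕ => P.real {ω | S A Z 0 n ω ∈ (n : ℝ) • Γ} /
      (n * P.real {ω | op (coefSum A) (Z 0 ω) ∈ (n : ℝ) • Γ})) atTop (𝓝 1) := by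
  obtain ⟨m, hm, hmev⟩ := hΓ.le_jumpProb hZ
  have hpos : ∀ᶠ n : ℕ in atTop, 0 < jumpProb P A Z Γ n :=
    hmev.mono fun n hn => (mul_pos hm (hZ.heavyTail.tail_pos n)).trans_le hn
  constructor
  · intro M δ hM hδ I hI hcard
    have hbpos : ∀ᶠ n : ℕ in atTop, ((I n).card : ℝ) * jumpProb P A Z Γ n ≠ 0 := by
      filter_upwards [hpos, hcard.eventually_gt_atTop 0] with n h1 h2
      have h2' : (0 : ℝ) < (I n).card := by exact_mod_cast h2
      positivity
    -- The second quantity, `|I_n| p_n`, is the common reference; any two are then compared by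
    -- transitivity.
    have hequiv : ∀ a : Fin 5, Asymptotics.IsEquivalent atTop (quantity P A Z Γ I M δ a)
        (fun n => ((I n).card : ℝ) * jumpProb P A Z Γ n) := by
      intro a
      refine isEquivalent_of_abs_sub_le card_mul_jumpProb_nonneg fun η hη => ?_
      fin_cases a
      · filter_upwards [hΓ.failure_close hA hZ hη, eventually_gt_atTop 0] with n hn hn0
        have hn' : (0 : ℝ) < n := by exact_mod_cast hn0
        set e := P.real {ω | S A Z 0 n ω ∈ (n : ℝ) • Γ} with he
        have hq : quantity P A Z Γ I M δ 0 n = (I n).card / n * e := rfl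
        change |quantity P A Z Γ I M δ 0 n - _| ≤ _
        have hr : (0 : ℝ) ≤ (I n).card / n := by positivity
        have h1 : ((I n).card : ℝ) * jumpProb P A Z Γ n =
            (I n).card / n * (n * jumpProb P A Z Γ n) := by field_simp
        rw [hq, h1, ← mul_sub, abs_mul, abs_of_nonneg hr, mul_left_comm η]
        exact mul_le_mul_of_nonneg_left hn hr
      · refine Eventually.of_forall fun n => ?_
        change |((I n).card : ℝ) * jumpProb P A Z Γ n - _| ≤ _
        rw [sub_self, abs_zero]
        exact mul_nonneg hη.le (card_mul_jumpProb_nonneg n)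
      · exact hΓ.jumpEvent_close hZ hI hη
      · exact hΓ.failure_jump_close hA hZ hI hcard hη
      · exact hΓ.failure_single_jump_close hA hZ hI hcard hM hδ hη
    have hne : ∀ a : Fin 5, ∀ᶠ n in atTop, quantity P A Z Γ I M δ a n ≠ 0 := by
      intro a
      have h1 := (Asymptotics.isEquivalent_iff_tendsto_one hbpos).1 (hequiv a)
      -- A quotient tending to `1` is eventually nonzero, hence so is its numerator.
      filter_upwards [h1.eventually_ne one_ne_zero] with n hn h0
      exact hn (by simp [h0])
    intro a b
    exact ⟨hne a, hne b, (Asymptotics.isEquivalent_iff_tendsto_one (hne b)).1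
      ((hequiv a).trans (hequiv b).symm)⟩
  · have hnp : ∀ᶠ n : ℕ in atTop, (n : ℝ) * jumpProb P A Z Γ n ≠ 0 := by
      filter_upwards [hpos, eventually_gt_atTop 0] with n h1 h2
      have h2' : (0 : ℝ) < n := by exact_mod_cast h2
      positivity
    exact (Asymptotics.isEquivalent_iff_tendsto_one hnp).1
      (isEquivalent_of_abs_sub_le (fun n => mul_nonneg n.cast_nonneg (jumpProb_nonneg n))
        fun η hη => hΓ.failure_close hA hZ hη)
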